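/- Let $p$ be an odd prime, $m\ge 1$, and for $m$ fixed let $\mathbb Q_p^{(m)}$ be the unramified extension of $\mathbb Q_p$ of degree $m$ in $\overline{\mathbb Q_p}$, with the norm $|\cdot|_p$ and the ring of integers $\mathbb Z_p^{(m)}=\{a : |a|_p\le 1\}$. Let $t=(t_1,\dots,t_r)$, $z=(z_1,\dots,z_n)$. Let $\mathbf e=(e_1,e_2,\dots)$ be a sequence of positive integers, $\Delta=(\Delta_0,\Delta_1,\dots)$ a sequence of subsets of $\mathbb Z^r$, all with the same number $g\ge 1$ of elements (each given with an enumeration, so that matrices indexed by $\Delta_i\times\Delta_j$ are $g\times g$ matrices), and $\Lambda=(\Lambda_0,\Lambda_1,\dots)$ a sequence of Laurent polynomials in $\mathbb Z_p[t^{\pm1},z^{\pm1}]$; assume that each of the three sequences has only finitely many distinct entries. Notation. For a Laurent polynomial $F(t,z)$ let $N(F)\subset\mathbb R^r$ be its Newton polytope with respect to $t$ only, let $\operatorname{Coeff}_vF\in\mathbb Z_p[z^{\pm1}]$ be the coefficient of $t^v$, and for finite $\Delta',\Delta''\subset\mathbb Z^r$ and $M\ge 0$ put $$A(M,\Delta',\Delta'',F)=\big(\operatorname{Coeff}_{p^Mv-u}F\big)_{u\in\Delta',\,v\in\Delta''}.$$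 Put $\sigma(G)(z)=G(z^p)$ for $G\in\mathbb Z_p[z^{\pm1}]$, applied entrywise to matrices, and $$W_s^{(j)}=\Lambda_j\,\Lambda_{j+1}^{p^{e_{j+1}}}\cdots\Lambda_s^{p^{e_{j+1}+\dots+e_s}},\qquad W_s=W_s^{(0)},\qquad W_0^{(1)}=1.$$ Assume that $\Lambda$ is $(\Delta,\mathbf e)$-admissible: for all $0\le i\le j$, $$\big(\Delta_i+N(\Lambda_i)+p^{e_{i+1}}N(\Lambda_{i+1})+\dots+p^{e_{i+1}+\dots+e_j}N(\Lambda_j)\big)\cap p^{e_{i+1}+\dots+e_{j+1}}\mathbb Z^r\subset p^{e_{i+1}+\dots+e_{j+1}}\Delta_{j+1};$$ and nondegenerate: for every $l\ge 0$ the Laurent polynomial $d_l(z)=\det A(e_{l+1},\Delta_l,\Delta_{l+1},\Lambda_l)$ is nonzero modulo $p$. Let $\mathfrak D^{(m)}$ be the set of all $a\in(\mathbb Z_p^{(m)})^n$ such that $|d_l(a)|_p=1$ for all $l\ge 0$; here, for the Laurent polynomials to be defined at $a$ over $\mathbb Z_p^{(m)}$, it is required that $|a_i|_p=1$ for every $i$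 such that $z_i$ occurs with a negative exponent in some $\Lambda_l$ (no requirement if the $\Lambda_l$ are polynomials in $z$). Then for every $s\ge 0$ the Laurent polynomial $$\det\sigma^{e_1}\big(A(e_2+\dots+e_{s+1},\Delta_1,\Delta_{s+1},W_s^{(1)})\big)$$ is nonzero modulo $p$ and has norm $1$ at every point of $\mathfrak D^{(m)}$, so that the entries of $$A\big(e_1+\dots+e_{s+1},\Delta_0,\Delta_{s+1},W_s\big)\cdot\sigma^{e_1}\big(A(e_2+\dots+e_{s+1},\Delta_1,\Delta_{s+1},W_s^{(1)})\big)^{-1}$$ are rational functions in $z$ regular on $\mathfrak D^{(m)}$. As $s\to\infty$ these matrices converge uniformly on $\mathfrak D^{(m)}$ to a $g\times g$ matrix $\mathcal A_\Lambda(z)$ with values in $\mathbb Z_p^{(m)}$ that is analytic: $\mathfrak D^{(m)}$ contains, with each of its points $a$, the unit polydisc $\{b\in(\mathbb Q_p^{(m)})^n : |b_i-a_i|_p<1 \text{ for all } i\}$, and on this polydisc every entry of $\mathcal A_\Lambda$ is the sum of a power series in $z-a$ that converges on the whole polydisc. For every $a\in\mathfrak D^{(m)}$ we have $|\det\mathcal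 A_\Lambda(a)|_p=1$, and the matrix $\mathcal A_\Lambda(a)$ is invertible. -/

import Mathlib

open scoped Pointwise

noncomputable section

namespace Dwork

/-- The Laurent polynomial ring `ℤ_p[z₁^{±1}, …, z_n^{±1}]`: exponents are vectors in `ℤⁿ`. -/
abbrev LaurentZ (p : ℕ) [Fact p.Prime] (n : ℕ) : Type :=
  AddMonoidAlgebra ℤ_[p] (Fin n → ℤ)

/-- The Laurent polynomial ring `ℤ_p[t₁^{±1}, …, t_r^{±1}, z₁^{±1}, …, z_n^{±1}]`: an exponent is
a pair consisting of the exponent of `t` and the exponent of `z`. -/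
abbrev LaurentTZ (p : ℕ) [Fact p.Prime] (r n : ℕ) : Type :=
  AddMonoidAlgebra ℤ_[p] ((Fin r → ℤ) × (Fin n → ℤ))

/-- The unramified extension `ℚ_p^{(m)}` of degree `m ≥ 1` of `ℚ_p` inside the algebraic closure of
`ℚ_p`, obtained by adjoining the roots of unity of order dividing `p ^ m - 1`. It carries the norm
of the algebraic closure, which extends `|·|_p`. -/
abbrev Qpm (p : ℕ) [Fact p.Prime] (m : ℕ) : IntermediateField ℚ_[p] (PadicAlgCl p) :=
  IntermediateField.adjoin ℚ_[p] {ζ : PadicAlgCl p | ζ ^ (p ^ m - 1) = 1}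

section Laurent

variable {p : ℕ} [Fact p.Prime] {r n : ℕ}

/-- `Coeff_v F`, the coefficient of `t ^ v` in `F(t, z)`, a Laurent polynomial in `z`. -/
def coeffT (v : Fin r → ℤ) (F : LaurentTZ p r n) : LaurentZ p n :=
  AddMonoidAlgebra.comapDomain (Prod.mk v) (Prod.mk_right_injective v) F

/-- `σ ^ k : G(z) ↦ G(z ^ (p ^ k))`. -/
def sigma (k : ℕ) (G : LaurentZ p n) : LaurentZ p n :=
  AddMonoidAlgebra.mapDomain (fun d : Fin n → ℤ => (p ^ k : ℕ) • d) G

/-- Some coefficient of `G` is not divisible by `p`. -/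
def NonzeroModP (G : LaurentZ p n) : Prop :=
  ∃ d : Fin n → ℤ, ¬ ((p : ℤ_[p]) ∣ G.coeff d)

/-- The value `G(a) ∈ ℚ_p^{(m)}` of a Laurent polynomial `G` at a point `a` (the value is the
expected one when `a i ≠ 0` for every variable that occurs in `G` with a negative exponent). -/
def evalAt {m : ℕ} (a : Fin n → Qpm p m) (G : LaurentZ p n) : Qpm p m :=
  ∑ d ∈ G.coeff.support,
    algebraMap ℚ_[p] (Qpm p m) (G.coeff d : ℚ_[p]) * ∏ i, a i ^ (d i)

/-- The Newton polytope of `F(t, z)` with respect to the variables `t` only. -/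
def newtonPolytope (F : LaurentTZ p r n) : Set (Fin r → ℝ) :=
  convexHull ℝ ((fun (k : (Fin r → ℤ) × (Fin n → ℤ)) (i : Fin r) => (k.1 i : ℝ)) ''
    (F.coeff.support : Set ((Fin r → ℤ) × (Fin n → ℤ))))

/-- The Hasse–Witt matrix `A(M, Δ', Δ'', F) = (Coeff_{p ^ M v - u} F)`, where `Δ'` and `Δ''` are
enumerated `g`-element subsets of `ℤ^r`; `u ∈ Δ'` indexes the rows, `v ∈ Δ''` the columns. -/
def hasseWitt {g : ℕ} (M : ℕ) (D' D'' : Fin g ↪ (Fin r → ℤ)) (F : LaurentTZ p r n) :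
    Matrix (Fin g) (Fin g) (LaurentZ p n) :=
  Matrix.of fun u v => coeffT ((p ^ M : ℕ) • D'' v - D' u) F

end Laurent

section Tuples

/-- `e_{i+1} + ⋯ + e_j` (it is `0` if `j ≤ i`). The entry `e 0` is never used. -/
def esum (e : ℕ → ℕ) (i j : ℕ) : ℕ := ∑ a ∈ Finset.Ioc i j, e a

variable (p : ℕ) [Fact p.Prime] {r n g : ℕ}

/-- `(Δ, e)`-admissibility of an infinite tuple of subsets of `ℝ^r`: for all `i ≤ j`,
`(Δ_i + N_i + p^{e_{i+1}} N_{i+1} + ⋯ + p^{e_{i+1}+⋯+e_j} N_j) ∩ p^{e_{i+1}+⋯+e_{j+1}} ℤ^r`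
is contained in `p^{e_{i+1}+⋯+e_{j+1}} Δ_{j+1}`. -/
def AdmissiblePolytopes (e : ℕ → ℕ) (Δ : ℕ → Fin g ↪ (Fin r → ℤ))
    (N : ℕ → Set (Fin r → ℝ)) : Prop :=
  ∀ i j : ℕ, i ≤ j → ∀ y : Fin r → ℤ,
    (fun k => ((p : ℝ) ^ esum e i (j + 1)) * (y k : ℝ)) ∈
      Set.range (fun (u : Fin g) (k : Fin r) => (Δ i u k : ℝ)) +
        ∑ l ∈ Finset.Icc i j, ((p : ℝ) ^ esum e i l) • N l →
    y ∈ Set.range (Δ (j + 1))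

variable {p}

/-- `(Δ, e)`-admissibility of an infinite tuple of Laurent polynomials. -/
def Admissible (e : ℕ → ℕ) (Δ : ℕ → Fin g ↪ (Fin r → ℤ)) (Λ : ℕ → LaurentTZ p r n) : Prop :=
  AdmissiblePolytopes p e Δ fun l => newtonPolytope (Λ l)

/-- The Laurent polynomial `det A(e_{l+1}, Δ_l, Δ_{l+1}, Λ_l)`. -/
def basicDet (e : ℕ → ℕ) (Δ : ℕ → Fin g ↪ (Fin r → ℤ)) (Λ : ℕ → LaurentTZ p r n) (l : ℕ) :
    LaurentZ p n :=
  (hasseWitt (e (l + 1)) (Δ l) (Δ (l + 1)) (Λ l)).det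

/-- All the determinants `det A(e_{l+1}, Δ_l, Δ_{l+1}, Λ_l)` are nonzero modulo `p`. -/
def Nondegenerate (e : ℕ → ℕ) (Δ : ℕ → Fin g ↪ (Fin r → ℤ)) (Λ : ℕ → LaurentTZ p r n) : Prop :=
  ∀ l, NonzeroModP (basicDet e Δ Λ l)

/-- `W_s^{(j)} = Λ_j Λ_{j+1}^{p^{e_{j+1}}} ⋯ Λ_s^{p^{e_{j+1}+⋯+e_s}}` (it is `1` if `s < j`);
`W_s = W_s^{(0)}`. -/
def W (e : ℕ → ℕ) (Λ : ℕ → LaurentTZ p r n) (j s : ℕ) : LaurentTZ p r n :=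
  ∏ l ∈ Finset.Icc j s, Λ l ^ (p ^ esum e j l)

/-- `A(e_{j+1}+⋯+e_{s+1}, Δ_j, Δ_{s+1}, W_s^{(j)})`. -/
def matA (e : ℕ → ℕ) (Δ : ℕ → Fin g ↪ (Fin r → ℤ)) (Λ : ℕ → LaurentTZ p r n) (j s : ℕ) :
    Matrix (Fin g) (Fin g) (LaurentZ p n) :=
  hasseWitt (esum e j (s + 1)) (Δ j) (Δ (s + 1)) (W e Λ j s)

/-- `σ^{e_1}(A(e_2+⋯+e_{s+1}, Δ_1, Δ_{s+1}, W_s^{(1)}))`. -/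
def sigmaMatA (e : ℕ → ℕ) (Δ : ℕ → Fin g ↪ (Fin r → ℤ)) (Λ : ℕ → LaurentTZ p r n) (s : ℕ) :
    Matrix (Fin g) (Fin g) (LaurentZ p n) :=
  (matA e Δ Λ 1 s).map (sigma (e 1))

/-- The value at `a` of the matrix of rational functions
`A(e_1+⋯+e_{s+1}, Δ_0, Δ_{s+1}, W_s) · σ^{e_1}(A(e_2+⋯+e_{s+1}, Δ_1, Δ_{s+1}, W_s^{(1)}))⁻¹`
(meaningful when the determinant of the second matrix does not vanish at `a`). -/
def ratioAt {m : ℕ} (e : ℕ → ℕ) (Δ : ℕ → Fin g ↪ (Fin r → ℤ)) (Λ : ℕ → LaurentTZ p r n)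
    (s : ℕ) (a : Fin n → Qpm p m) : Matrix (Fin g) (Fin g) (Qpm p m) :=
  (matA e Δ Λ 0 s).map (evalAt a) * ((sigmaMatA e Δ Λ s).map (evalAt a))⁻¹

/-- The domain `𝔇^{(m)}`: the points `a` of `(ℤ_p^{(m)})ⁿ` at which the Laurent polynomials are
defined over `ℤ_p^{(m)}` (that is, `a i` is invertible in `ℤ_p^{(m)}` for each `i` such that `z_i`
occurs with a negative exponent in some `Λ_l`) and at which all the determinants
`det A(e_{l+1}, Δ_l, Δ_{l+1}, Λ_l)` have norm `1`. -/
def domainD (m : ℕ) (e : ℕ → ℕ) (Δ : ℕ → Fin g ↪ (Fin r → ℤ)) (Λ : ℕ → LaurentTZ p r n) :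
    Set (Fin n → Qpm p m) :=
  {a | (∀ i, ‖a i‖ ≤ 1) ∧
    (∀ i, (∃ l, ∃ k ∈ (Λ l).coeff.support, k.2 i < 0) → ‖a i‖ = 1) ∧
    ∀ l, ‖evalAt a (basicDet e Δ Λ l)‖ = 1}

end Tuples

end Dwork

end

/-! Let `φ` be the Frobenius lift raising every `t` and `z` to the `p`-th power and fixing
coefficients. The products decompose as `W_s^{(i)} = ∑_{i ≤ j ≤ s} V_j^{(i)}
φ^{e_{i+1}+⋯+e_{j+1}}(W_s^{(j+1)})`, where the ghost terms `V_j^{(i)}` do not depend on `s`. Two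
facts make this useful. First, `p^{j-i}` divides `V_j^{(i)}` (`prime_pow_dvd_ghost`), because
`F^{p^{k+l}} ≡ φ^k(F)^{p^l}` modulo `p^{l+1}`. Second, `V_j^{(i)}` obeys the same Newton polytope
bound as `W_j^{(i)}` (`suppIn_ghost`), so admissibility turns the Hasse–Witt matrix of each summand
into a matrix product (`hasseWitt_mul_frob`).

After suitable Frobenius twists, the Hasse–Witt matrices `M(i,s)` of `W_s^{(i)}` thus satisfy a
triangular system `M(i,s) = ∑_j p^{j-i} b(i,j) M(j+1,s)` with `b` independent of `s`. Modulo `p`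
only `j = i` survives, so each determinant is congruent to a product of Frobenius twists of the
`d_l`; this gives nonvanishing modulo `p` and norm `1` on the domain. The full system gives, by
induction on `s - i`, the Dwork congruences `M(i,s+1) M(i+1,s+1)⁻¹ ≡ M(i,s) M(i+1,s)⁻¹` modulo
`p^{s+1-i}` (`prime_pow_dvd_ratio_sub`).

For analyticity these congruences are read in the ring of functions on the domain that are given on
each open unit polydisc by a power series with integral coefficients. Such functions are bounded by
`1`, those of constant norm `1` are units, and sums `∑ p^s f_s` stay in the ring. Hence the ratios
`Q_s` converge uniformly, and the limit is analytic. It is congruent modulo `p` to the invertible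
matrix `Q_0`, so its determinant has norm `1` (`exists_limit`). -/

noncomputable section

namespace Dwork

/-! ### Frobenius lifts and supports of Laurent polynomials -/

section Frobenius

variable {p : ℕ} [Fact p.Prime] {Γ : Type*} [AddCommMonoid Γ]

/-- The Frobenius lift `x ^ d ↦ x ^ (p ^ k d)`, which fixes the coefficients. -/
def frob (k : ℕ) : AddMonoidAlgebra ℤ_[p] Γ →+* AddMonoidAlgebra ℤ_[p] Γ :=
  AddMonoidAlgebra.mapDomainRingHom ℤ_[p] (nsmulAddMonoidHom (p ^ k))

theorem frob_single (k : ℕ) (d : Γ) (c : ℤ_[p]) :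
    frob k (AddMonoidAlgebra.single d c) = AddMonoidAlgebra.single ((p ^ k) • d) c := by
  simp [frob]

theorem frob_frob (k l : ℕ) (F : AddMonoidAlgebra ℤ_[p] Γ) :
    frob k (frob l F) = frob (k + l) F := by
  induction F using AddMonoidAlgebra.induction_linear with
  | zero => simp
  | add F G hF hG => simp [hF, hG]
  | single d c => simp only [frob_single, smul_smul, pow_add]

theorem frob_zero (F : AddMonoidAlgebra ℤ_[p] Γ) : frob 0 F = F := by
  induction F using AddMonoidAlgebra.induction_linear with
  | zero => simp
  | add F G hF hG => simp [hF, hG]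
  | single d c => simp [frob_single]

theorem PadicInt.prime_dvd_pow_sub (c : ℤ_[p]) (k : ℕ) : (p : ℤ_[p]) ∣ c ^ p ^ k - c := by
  rw [← Ideal.mem_span_singleton, ← PadicInt.maximalIdeal_eq_span_p, ← PadicInt.ker_toZMod,
    RingHom.mem_ker, map_sub, map_pow, ZMod.pow_card_pow, sub_self]

/-- Modulo `p` both operations are additive, so monomials suffice; there it is Fermat's congruence
for the coefficient. -/
theorem prime_dvd_pow_sub_frob (k : ℕ) (F : AddMonoidAlgebra ℤ_[p] Γ) :
    (p : AddMonoidAlgebra ℤ_[p] Γ) ∣ F ^ p ^ k - frob k F := by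
  have hp : p.Prime := Fact.out
  induction F using AddMonoidAlgebra.induction_linear with
  | zero => simp [zero_pow (pow_pos hp.pos k).ne']
  | add F G hF hG =>
    obtain ⟨r, hr⟩ := exists_add_pow_prime_pow_eq hp F G k
    rw [hr, map_add]
    have : F ^ p ^ k + G ^ p ^ k + ↑p * F * G * r - (frob k F + frob k G) =
      (F ^ p ^ k - frob k F) + (G ^ p ^ k - frob k G) + p * (F * G * r) := by ring
    rw [this]
    exact dvd_add (dvd_add hF hG) (dvd_mul_right _ _)
  | single d c =>
    obtain ⟨b, hb⟩ := PadicInt.prime_dvd_pow_sub c k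
    refine ⟨AddMonoidAlgebra.single ((p ^ k) • d) b, ?_⟩
    rw [frob_single, AddMonoidAlgebra.single_pow, ← AddMonoidAlgebra.single_sub, hb,
      AddMonoidAlgebra.natCast_def, AddMonoidAlgebra.single_mul_single, zero_add]

/-- Each `p`-th power of a congruence modulo a power of `p` gains one factor `p`. -/
theorem prime_pow_dvd_pow_sub_frob_pow (k l : ℕ) (F : AddMonoidAlgebra ℤ_[p] Γ) :
    (p : AddMonoidAlgebra ℤ_[p] Γ) ^ (l + 1) ∣ F ^ p ^ (k + l) - frob k F ^ p ^ l := by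
  rw [pow_add p, pow_mul]
  exact dvd_sub_pow_of_dvd_sub (prime_dvd_pow_sub_frob k F) l

theorem coeff_natCast_mul (c : ℕ) (F : AddMonoidAlgebra ℤ_[p] Γ) (d : Γ) :
    ((c : AddMonoidAlgebra ℤ_[p] Γ) * F).coeff d = c * F.coeff d := by
  rw [← nsmul_eq_mul, AddMonoidAlgebra.coeff_smul]
  simp

theorem coeff_prime_pow_mul_ne_zero_iff (k : ℕ) (F : AddMonoidAlgebra ℤ_[p] Γ) (d : Γ) :
    ((p : AddMonoidAlgebra ℤ_[p] Γ) ^ k * F).coeff d ≠ 0 ↔ F.coeff d ≠ 0 := by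
  have hp : p.Prime := Fact.out
  rw [← Nat.cast_pow, coeff_natCast_mul]
  simp [hp.ne_zero]

/-- The polynomials with exponents in a submonoid. -/
def supportSubring (E : AddSubmonoid Γ) : Subring (AddMonoidAlgebra ℤ_[p] Γ) where
  carrier := {F | ∀ d, F.coeff d ≠ 0 → d ∈ E}
  mul_mem' := by
    classical
    intro F G hF hG d hd
    have h := AddMonoidAlgebra.support_coeff_mul_subset F G (Finsupp.mem_support_iff.2 hd)
    obtain ⟨x, hx, y, hy, rfl⟩ := Finset.mem_add.1 h
    exact E.add_mem (hF x (Finsupp.mem_support_iff.1 hx)) (hG y (Finsupp.mem_support_iff.1 hy))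
  one_mem' := by
    intro d hd
    rw [AddMonoidAlgebra.one_def, AddMonoidAlgebra.coeff_single] at hd
    by_cases h : d = 0
    · exact h ▸ E.zero_mem
    · exact absurd (Finsupp.single_eq_of_ne h) hd
  add_mem' := by
    intro F G hF hG d hd
    by_cases h : F.coeff d = 0
    · refine hG d fun h' => hd ?_
      simp [h, h']
    · exact hF d h
  zero_mem' := by simp
  neg_mem' := by
    intro F hF d hd
    exact hF d (by simpa using hd)

theorem mem_supportSubring {E : AddSubmonoid Γ} {F : AddMonoidAlgebra ℤ_[p] Γ} :
    F ∈ supportSubring E ↔ ∀ d, F.coeff d ≠ 0 → d ∈ E := Iff.rfl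

/-- The coefficients are torsion-free, so quotients by powers of `p` keep the exponents of the
dividend. -/
theorem prime_pow_mul_mem_supportSubring_iff {E : AddSubmonoid Γ} (k : ℕ)
    {F : AddMonoidAlgebra ℤ_[p] Γ} :
    (p : AddMonoidAlgebra ℤ_[p] Γ) ^ k * F ∈ supportSubring E ↔ F ∈ supportSubring E := by
  simp only [mem_supportSubring, coeff_prime_pow_mul_ne_zero_iff]

theorem exists_coeff_ne_zero_of_frob (k : ℕ) (F : AddMonoidAlgebra ℤ_[p] Γ) (d : Γ)
    (h : (frob k F).coeff d ≠ 0) : ∃ d', F.coeff d' ≠ 0 ∧ (p ^ k) • d' = d := by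
  classical
  have : d ∈ (Finsupp.mapDomain (nsmulAddMonoidHom (p ^ k)) F.coeff).support :=
    Finsupp.mem_support_iff.2 h
  obtain ⟨d', hd', rfl⟩ := Finset.mem_image.1 (Finsupp.mapDomain_support this)
  exact ⟨d', Finsupp.mem_support_iff.1 hd', rfl⟩

theorem frob_mem_supportSubring {E : AddSubmonoid Γ} (k : ℕ) {F : AddMonoidAlgebra ℤ_[p] Γ}
    (hF : F ∈ supportSubring E) : frob k F ∈ supportSubring E := by
  intro d hd
  obtain ⟨d', hd', rfl⟩ := exists_coeff_ne_zero_of_frob k F d hd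
  exact E.nsmul_mem (hF d' hd') _

/-- The exponents of `F` are mapped into `S` by `ψ`. -/
def SuppIn {V : Type*} [AddCommGroup V] (ψ : Γ →+ V) (F : AddMonoidAlgebra ℤ_[p] Γ) (S : Set V) :
    Prop :=
  ∀ d, F.coeff d ≠ 0 → ψ d ∈ S

namespace SuppIn

variable {V : Type*} [AddCommGroup V] {ψ : Γ →+ V} {F G : AddMonoidAlgebra ℤ_[p] Γ} {S T : Set V}

theorem mul (hF : SuppIn ψ F S) (hG : SuppIn ψ G T) : SuppIn ψ (F * G) (S + T) := by
  classical
  intro d hd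
  have h := AddMonoidAlgebra.support_coeff_mul_subset F G (Finsupp.mem_support_iff.2 hd)
  obtain ⟨x, hx, y, hy, rfl⟩ := Finset.mem_add.1 h
  rw [map_add]
  exact Set.add_mem_add (hF x (Finsupp.mem_support_iff.1 hx)) (hG y (Finsupp.mem_support_iff.1 hy))

theorem sub (hF : SuppIn ψ F S) (hG : SuppIn ψ G S) : SuppIn ψ (F - G) S := by
  intro d hd
  by_cases h : F.coeff d = 0
  · refine hG d fun h' => hd ?_
    simp [h, h']
  · exact hF d h

theorem sum {ι : Type*} {s : Finset ι} {f : ι → AddMonoidAlgebra ℤ_[p] Γ}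
    (hf : ∀ i ∈ s, SuppIn ψ (f i) S) : SuppIn ψ (∑ i ∈ s, f i) S := by
  intro d hd
  have : (∑ i ∈ s, f i).coeff d = ∑ i ∈ s, (f i).coeff d := by
    rw [AddMonoidAlgebra.coeff_sum, Finsupp.finsetSum_apply]
  rw [this] at hd
  obtain ⟨i, hi, h⟩ := Finset.exists_ne_zero_of_sum_ne_zero hd
  exact hf i hi d h

theorem one : SuppIn ψ (1 : AddMonoidAlgebra ℤ_[p] Γ) 0 := by
  intro d hd
  rw [AddMonoidAlgebra.one_def, AddMonoidAlgebra.coeff_single] at hd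
  by_cases h : d = 0
  · simp [h]
  · exact absurd (Finsupp.single_eq_of_ne h) hd

theorem prod {ι : Type*} {s : Finset ι} {f : ι → AddMonoidAlgebra ℤ_[p] Γ} {T : ι → Set V}
    (hf : ∀ i ∈ s, SuppIn ψ (f i) (T i)) : SuppIn ψ (∏ i ∈ s, f i) (∑ i ∈ s, T i) := by
  classical
  induction s using Finset.induction_on with
  | empty => simpa using one
  | insert a s ha ih =>
    rw [Finset.prod_insert ha, Finset.sum_insert ha]
    exact (hf a (Finset.mem_insert_self a s)).mul
      (ih fun i hi => hf i (Finset.mem_insert_of_mem hi))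

/-- Convexity is what identifies the iterated sum `S + ⋯ + S` with the dilation of `S`. -/
theorem pow_succ [Module ℝ V] (hF : SuppIn ψ F S) (hS : Convex ℝ S) (k : ℕ) :
    SuppIn ψ (F ^ (k + 1)) (((k + 1 : ℕ) : ℝ) • S) := by
  induction k with
  | zero => simpa using hF
  | succ k ih =>
    have h := ih.mul hF
    rw [← _root_.pow_succ] at h
    have e : (((k + 1 + 1 : ℕ) : ℝ) • S) = ((k + 1 : ℕ) : ℝ) • S + S := by
      push_cast
      rw [hS.add_smul (p := (k : ℝ) + 1) (q := 1) (by positivity) zero_le_one, one_smul]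
    rwa [e]

theorem pow [Module ℝ V] (hF : SuppIn ψ F S) (hS : Convex ℝ S) {k : ℕ} (hk : k ≠ 0) :
    SuppIn ψ (F ^ k) ((k : ℝ) • S) := by
  obtain ⟨k, rfl⟩ := Nat.exists_eq_succ_of_ne_zero hk
  exact hF.pow_succ hS k

theorem frob [Module ℝ V] (hF : SuppIn ψ F S) (k : ℕ) :
    SuppIn ψ (frob k F) ((p : ℝ) ^ k • S) := by
  intro d hd
  obtain ⟨d', hd', rfl⟩ := exists_coeff_ne_zero_of_frob k F d hd
  refine ⟨ψ d', hF d' hd', ?_⟩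
  simp only [map_nsmul]
  rw [← Nat.cast_smul_eq_nsmul ℝ, Nat.cast_pow]

end SuppIn

end Frobenius

/-! ### Ghost terms: divisibility and Newton polytopes -/

section Ghosts

variable {p : ℕ} [Fact p.Prime] {r n g : ℕ}

theorem esum_add (e : ℕ → ℕ) {i j k : ℕ} (hij : i ≤ j) (hjk : j ≤ k) :
    esum e i j + esum e j k = esum e i k :=
  Finset.sum_Ioc_consecutive _ hij hjk

theorem esum_self (e : ℕ → ℕ) (i : ℕ) : esum e i i = 0 := by simp [esum]

theorem esum_succ_self (e : ℕ → ℕ) (i : ℕ) : esum e i (i + 1) = e (i + 1) := by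
  simp [esum]

theorem sub_le_esum {e : ℕ → ℕ} (he : ∀ l, 0 < e (l + 1)) (i j : ℕ) : j - i ≤ esum e i j := by
  have h : ∀ a ∈ Finset.Ioc i j, 1 ≤ e a := by
    intro a ha
    obtain ⟨b, rfl⟩ : ∃ b, a = b + 1 := ⟨a - 1, by have := (Finset.mem_Ioc.1 ha).1; omega⟩
    exact he b
  calc j - i = ∑ a ∈ Finset.Ioc i j, 1 := by simp
    _ ≤ _ := Finset.sum_le_sum h

theorem W_self (e : ℕ → ℕ) (Λ : ℕ → LaurentTZ p r n) (i : ℕ) : W e Λ i i = Λ i := by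
  simp [W, esum_self]

theorem W_succ_self (e : ℕ → ℕ) (Λ : ℕ → LaurentTZ p r n) (i : ℕ) : W e Λ (i + 1) i = 1 := by
  simp [W]

theorem W_succ_right (e : ℕ → ℕ) (Λ : ℕ → LaurentTZ p r n) {i s : ℕ} (h : i ≤ s + 1) :
    W e Λ i (s + 1) = W e Λ i s * Λ (s + 1) ^ p ^ esum e i (s + 1) :=
  Finset.prod_Icc_succ_top h _

/-- The ghost terms of the products `W`, defined so that
`W_s^{(i)} = ∑_{i ≤ j ≤ s} V_j^{(i)} φ^{e_{i+1}+⋯+e_{j+1}}(W_s^{(j+1)})`. -/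
def ghost (e : ℕ → ℕ) (Λ : ℕ → LaurentTZ p r n) (i s : ℕ) : LaurentTZ p r n :=
  W e Λ i s - ∑ j ∈ (Finset.Ico i s).attach,
    have : j.1 < s := (Finset.mem_Ico.1 j.2).2
    ghost e Λ i j.1 * frob (esum e i (j.1 + 1)) (W e Λ (j.1 + 1) s)
termination_by s

theorem ghost_eq (e : ℕ → ℕ) (Λ : ℕ → LaurentTZ p r n) (i s : ℕ) :
    ghost e Λ i s = W e Λ i s -
      ∑ j ∈ Finset.Ico i s, ghost e Λ i j * frob (esum e i (j + 1)) (W e Λ (j + 1) s) := by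
  rw [ghost, ← Finset.sum_attach (Finset.Ico i s)]

theorem ghost_self (e : ℕ → ℕ) (Λ : ℕ → LaurentTZ p r n) (i : ℕ) : ghost e Λ i i = Λ i := by
  rw [ghost_eq, Finset.Ico_self, Finset.sum_empty, sub_zero, W_self]

theorem W_eq_sum_ghost (e : ℕ → ℕ) (Λ : ℕ → LaurentTZ p r n) {i s : ℕ} (h : i ≤ s) :
    W e Λ i s =
      ∑ j ∈ Finset.Icc i s, ghost e Λ i j * frob (esum e i (j + 1)) (W e Λ (j + 1) s) := by
  rw [← Finset.Ico_succ_right_eq_Icc, Nat.succ_eq_succ, Nat.succ_eq_add_one,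
    Finset.sum_Ico_succ_top h, W_succ_self,
    map_one, mul_one, ghost_eq e Λ i s]
  ring

/-- Multiply the decomposition of `W_s` by the new factor and subtract it from the recursion at `s +
1`: each summand keeps only the discrepancy between power and Frobenius of `Λ_{s+1}`. -/
theorem ghost_succ (e : ℕ → ℕ) (Λ : ℕ → LaurentTZ p r n) {i s : ℕ} (h : i ≤ s) :
    ghost e Λ i (s + 1) = ∑ j ∈ Finset.Icc i s,
      ghost e Λ i j * frob (esum e i (j + 1)) (W e Λ (j + 1) s) *
        (Λ (s + 1) ^ p ^ esum e i (s + 1) -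
          frob (esum e i (j + 1)) (Λ (s + 1)) ^ p ^ esum e (j + 1) (s + 1)) := by
  rw [ghost_eq, W_succ_right e Λ (by omega), W_eq_sum_ghost e Λ h, Finset.sum_mul,
    ← Finset.Ico_succ_right_eq_Icc, Nat.succ_eq_succ, Nat.succ_eq_add_one,
    ← Finset.sum_sub_distrib]
  refine Finset.sum_congr rfl fun j hj => ?_
  rw [W_succ_right e Λ (by have := Finset.mem_Ico.1 hj; omega), map_mul, map_pow]
  ring

theorem prime_pow_dvd_ghost {e : ℕ → ℕ} (he : ∀ l, 0 < e (l + 1)) (Λ : ℕ → LaurentTZ p r n)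
    (i s : ℕ) : (p : LaurentTZ p r n) ^ (s - i) ∣ ghost e Λ i s := by
  induction s using Nat.strong_induction_on with
  | _ s ih =>
    rcases Nat.lt_or_ge i s with h | h
    · obtain ⟨s, rfl⟩ : ∃ t, s = t + 1 := ⟨s - 1, by omega⟩
      rw [ghost_succ e Λ (by omega)]
      refine Finset.dvd_sum fun j hj => ?_
      have hj' := Finset.mem_Icc.1 hj
      have h1 := ih j (by omega)
      have h2 := prime_pow_dvd_pow_sub_frob_pow (esum e i (j + 1)) (esum e (j + 1) (s + 1))
        (Λ (s + 1))
      rw [esum_add e (by omega) (by omega)] at h2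
      -- The ghost contributes `p^{j-i}` and the discrepancy `p^{e_{j+2}+⋯+e_{s+1}+1}`; since every
      -- `e` is at least `1`, the total exponent is at least `s + 1 - i`.
      refine (pow_dvd_pow _ ?_).trans ((pow_add _ _ _).dvd.trans
        (mul_dvd_mul (h1.mul_right _) h2))
      have := sub_le_esum he (j + 1) (s + 1)
      omega
    · rw [Nat.sub_eq_zero_of_le h, pow_zero]
      exact one_dvd _

/-- The exponent of `t`, as a real vector. -/
def tExp (r n : ℕ) : (Fin r → ℤ) × (Fin n → ℤ) →+ (Fin r → ℝ) where
  toFun k i := (k.1 i : ℝ)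
  map_zero' := by ext; simp
  map_add' := by intros; ext; simp

theorem suppIn_newtonPolytope (F : LaurentTZ p r n) : SuppIn (tExp r n) F (newtonPolytope F) := by
  intro d hd
  exact subset_convexHull ℝ _ ⟨d, Finsupp.mem_support_iff.2 hd, rfl⟩

theorem suppIn_W (e : ℕ → ℕ) (Λ : ℕ → LaurentTZ p r n) (i s : ℕ) :
    SuppIn (tExp r n) (W e Λ i s)
      (∑ l ∈ Finset.Icc i s, ((p : ℝ) ^ esum e i l) • newtonPolytope (Λ l)) := by
  have hp : p.Prime := Fact.out
  refine SuppIn.prod fun l _ => ?_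
  have := (suppIn_newtonPolytope (Λ l)).pow (convex_convexHull ℝ _)
    (k := p ^ esum e i l) (pow_pos hp.pos _).ne'
  rwa [Nat.cast_pow] at this

/-- `φ^k` dilates a polytope by `p^k`, exactly as the `p^k`-th power does, so every term of the
recursion has the bound of `W`. -/
theorem suppIn_ghost (e : ℕ → ℕ) (Λ : ℕ → LaurentTZ p r n) (i s : ℕ) :
    SuppIn (tExp r n) (ghost e Λ i s)
      (∑ l ∈ Finset.Icc i s, ((p : ℝ) ^ esum e i l) • newtonPolytope (Λ l)) := by
  induction s using Nat.strong_induction_on with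
  | _ s ih =>
    rw [ghost_eq]
    refine (suppIn_W e Λ i s).sub (SuppIn.sum fun j hj => ?_)
    have hj' := Finset.mem_Ico.1 hj
    have h := (ih j hj'.2).mul ((suppIn_W e Λ (j + 1) s).frob (esum e i (j + 1)))
    convert h using 1
    have hsum : ∀ f : ℕ → Set (Fin r → ℝ), ∑ l ∈ Finset.Icc i s, f l =
        ∑ l ∈ Finset.Icc i j, f l + ∑ l ∈ Finset.Icc (j + 1) s, f l := by
      intro f
      have := Finset.sum_Ico_consecutive f (m := i) (n := j + 1) (k := s + 1)
        (by omega) (by omega)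
      simpa only [← Finset.Ico_succ_right_eq_Icc, Nat.succ_eq_succ, Nat.succ_eq_add_one]
        using this.symm
    rw [hsum, Finset.smul_sum]
    congr 1
    refine Finset.sum_congr rfl fun l hl => ?_
    have hl' := Finset.mem_Icc.1 hl
    rw [smul_smul, ← pow_add, esum_add e (by omega) hl'.1]

theorem W_mem_supportSubring {E : AddSubmonoid ((Fin r → ℤ) × (Fin n → ℤ))} (e : ℕ → ℕ)
    {Λ : ℕ → LaurentTZ p r n} (hΛ : ∀ l, Λ l ∈ supportSubring E) (i s : ℕ) :
    W e Λ i s ∈ supportSubring E :=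
  Subring.prod_mem _ fun l _ => Subring.pow_mem _ (hΛ l) _

theorem ghost_mem_supportSubring {E : AddSubmonoid ((Fin r → ℤ) × (Fin n → ℤ))} (e : ℕ → ℕ)
    {Λ : ℕ → LaurentTZ p r n} (hΛ : ∀ l, Λ l ∈ supportSubring E) (i s : ℕ) :
    ghost e Λ i s ∈ supportSubring E := by
  induction s using Nat.strong_induction_on with
  | _ s ih =>
    rw [ghost_eq]
    exact Subring.sub_mem _ (W_mem_supportSubring e hΛ i s) (Subring.sum_mem _ fun j hj =>
      Subring.mul_mem _ (ih j (Finset.mem_Ico.1 hj).2)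
        (frob_mem_supportSubring _ (W_mem_supportSubring e hΛ _ _)))

end Ghosts

/-! ### Hasse–Witt matrices and their triangular expansion -/

section HasseWitt

variable {p : ℕ} [Fact p.Prime] {r n g : ℕ}

theorem sigma_eq_frob (k : ℕ) : (sigma k : LaurentZ p n → LaurentZ p n) = frob k := rfl

theorem coeffT_coeff (v : Fin r → ℤ) (F : LaurentTZ p r n) (d : Fin n → ℤ) :
    (coeffT v F).coeff d = F.coeff (v, d) := rfl

theorem coeffT_add (v : Fin r → ℤ) (F G : LaurentTZ p r n) :
    coeffT v (F + G) = coeffT v F + coeffT v G :=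
  AddMonoidAlgebra.comapDomain_add _ _ _ _

theorem coeffT_zero (v : Fin r → ℤ) : coeffT v (0 : LaurentTZ p r n) = 0 :=
  AddMonoidAlgebra.comapDomain_zero _ _

theorem coeffT_single (v : Fin r → ℤ) (k : (Fin r → ℤ) × (Fin n → ℤ)) (c : ℤ_[p]) :
    coeffT v (AddMonoidAlgebra.single k c) =
      if k.1 = v then AddMonoidAlgebra.single k.2 c else 0 := by
  obtain ⟨x, d⟩ := k
  split_ifs with h
  · subst h
    exact AddMonoidAlgebra.comapDomain_single_map _ _ _ _
  · ext d'
    rw [coeffT_coeff, AddMonoidAlgebra.coeff_single, Finsupp.single_eq_of_ne]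
    · rfl
    · exact fun h' => h (congrArg Prod.fst h').symm

theorem hasseWitt_add (M : ℕ) (D' D'' : Fin g ↪ (Fin r → ℤ)) (F G : LaurentTZ p r n) :
    hasseWitt M D' D'' (F + G) = hasseWitt M D' D'' F + hasseWitt M D' D'' G := by
  ext1 u v
  exact coeffT_add _ _ _

theorem hasseWitt_zero (M : ℕ) (D' D'' : Fin g ↪ (Fin r → ℤ)) :
    hasseWitt M D' D'' (0 : LaurentTZ p r n) = 0 := by
  ext1 u v
  exact coeffT_zero _

theorem hasseWitt_sum {ι : Type*} (s : Finset ι) (f : ι → LaurentTZ p r n) (M : ℕ)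
    (D' D'' : Fin g ↪ (Fin r → ℤ)) :
    hasseWitt M D' D'' (∑ i ∈ s, f i) = ∑ i ∈ s, hasseWitt M D' D'' (f i) :=
  map_sum (AddMonoidHom.mk' (hasseWitt M D' D'') (hasseWitt_add M D' D'')) f s

theorem hasseWitt_prime_pow_mul (M k : ℕ) (D' D'' : Fin g ↪ (Fin r → ℤ)) (F : LaurentTZ p r n) :
    hasseWitt M D' D'' ((p : LaurentTZ p r n) ^ k * F) =
      (p ^ k : ℕ) • hasseWitt M D' D'' F := by
  rw [← Nat.cast_pow, ← nsmul_eq_mul]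
  exact map_nsmul (AddMonoidHom.mk' (hasseWitt M D' D'') (hasseWitt_add M D' D'')) _ _

theorem hasseWitt_mem_supportSubring {E : AddSubmonoid (Fin n → ℤ)} {F : LaurentTZ p r n}
    (hF : F ∈ supportSubring (E.comap (AddMonoidHom.snd (Fin r → ℤ) (Fin n → ℤ)))) (M : ℕ)
    (D' D'' : Fin g ↪ (Fin r → ℤ)) (u v : Fin g) :
    hasseWitt M D' D'' F u v ∈ supportSubring E :=
  fun d hd => hF (_, d) hd

theorem hasseWitt_one (D : Fin g ↪ (Fin r → ℤ)) :
    hasseWitt 0 D D (1 : LaurentTZ p r n) = 1 := by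
  ext1 u v
  rw [AddMonoidAlgebra.one_def]
  simp only [hasseWitt, Matrix.of_apply, coeffT_single, Matrix.one_apply, pow_zero, one_smul]
  by_cases h : u = v
  · simp [h, AddMonoidAlgebra.one_def]
  · have : (0 : Fin r → ℤ) ≠ D v - D u := fun h' => h (D.injective (sub_eq_zero.1 h'.symm).symm)
    simp [h, this]

/-- A contribution to the `(u, v)` entry comes from exponents with `k + p^M l = p^{M+M'} v - u`.
Then `k + u` lies in `p^M ℤ^r`, so `k + u = p^M w` with `w ∈ D` by hypothesis; summing over `w` is
the matrix product. -/
theorem hasseWitt_mul_frob (M M' : ℕ) (D' D D'' : Fin g ↪ (Fin r → ℤ)) (F G : LaurentTZ p r n)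
    (hF : ∀ k, F.coeff k ≠ 0 → ∀ u y, k.1 + D' u = (p ^ M : ℕ) • y → y ∈ Set.range D) :
    hasseWitt (M + M') D' D'' (F * frob M G) =
      hasseWitt M D' D F * (hasseWitt M' D D'' G).map (sigma M) := by
  have hp : p.Prime := Fact.out
  rw [sigma_eq_frob]
  have hmono : ∀ (k : (Fin r → ℤ) × (Fin n → ℤ)) (c : ℤ_[p]),
      (∀ u y, k.1 + D' u = (p ^ M : ℕ) • y → y ∈ Set.range D) →
      hasseWitt (M + M') D' D'' (AddMonoidAlgebra.single k c * frob M G) =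
      hasseWitt M D' D (AddMonoidAlgebra.single k c) * (hasseWitt M' D D'' G).map (frob M) := by
    intro k c hk
    induction G using AddMonoidAlgebra.induction_linear with
    | zero =>
      simp only [map_zero, mul_zero, hasseWitt_zero]
      rw [Matrix.map_zero _ (map_zero _), Matrix.mul_zero]
    | add G H hG hH =>
      rw [map_add, mul_add, hasseWitt_add, hG, hH, hasseWitt_add, Matrix.map_add _ (map_add _),
        Matrix.mul_add]
    | single l b =>
      ext1 u v
      rw [Matrix.mul_apply, frob_single, AddMonoidAlgebra.single_mul_single]
      simp only [hasseWitt, Matrix.of_apply, Matrix.map_apply, coeffT_single]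
      -- For a pair of monomials either exactly one `w` contributes, or `k + u` is not divisible by
      -- `p^M` and both sides vanish.
      by_cases h : ∃ y, k.1 + D' u = (p ^ M : ℕ) • y
      · obtain ⟨y, hy⟩ := h
        obtain ⟨w, rfl⟩ := hk u y hy
        have hinj : ∀ x y : Fin r → ℤ, (p ^ M : ℕ) • x = (p ^ M : ℕ) • y ↔ x = y := fun x y =>
          (smul_right_injective (Fin r → ℤ) (pow_pos hp.pos M).ne').eq_iff
        have hkD : ∀ w', k.1 = (p ^ M : ℕ) • D w' - D' u ↔ w = w' := by
          intro w'
          rw [eq_sub_iff_add_eq, hy, hinj, D.injective.eq_iff]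
        simp only [hkD, ite_mul, zero_mul]
        rw [Finset.sum_ite_eq Finset.univ w, if_pos (Finset.mem_univ w)]
        have hcond : (k + (p ^ M) • l).1 = (p ^ (M + M') : ℕ) • D'' v - D' u ↔
            l.1 = (p ^ M' : ℕ) • D'' v - D w := by
          rw [eq_sub_iff_add_eq, eq_sub_iff_add_eq, Prod.fst_add, Prod.smul_fst, add_right_comm, hy,
            ← smul_add, pow_add, mul_smul, hinj, add_comm]
        simp only [hcond]
        split_ifs
        · rw [frob_single, AddMonoidAlgebra.single_mul_single]
          rfl
        · rw [map_zero, mul_zero]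
      · rw [if_neg, Finset.sum_eq_zero]
        · intro w _
          rw [if_neg, zero_mul]
          intro h'
          exact h ⟨D w, by rw [h', sub_add_cancel]⟩
        · intro h'
          refine h ⟨(p ^ M' : ℕ) • D'' v - l.1, ?_⟩
          rw [Prod.fst_add, Prod.smul_fst, eq_sub_iff_add_eq] at h'
          rw [smul_sub, smul_smul, ← pow_add, ← h']
          abel
  have hFsum : F = ∑ k ∈ F.coeff.support, AddMonoidAlgebra.single k (F.coeff k) :=
    (AddMonoidAlgebra.sum_coeff_single F).symm
  rw [hFsum, Finset.sum_mul, hasseWitt_sum, hasseWitt_sum, Finset.sum_mul]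
  exact Finset.sum_congr rfl fun k hk => hmono k _ (hF k (Finsupp.mem_support_iff.1 hk))

theorem matA_succ_self (e : ℕ → ℕ) (Δ : ℕ → Fin g ↪ (Fin r → ℤ)) (Λ : ℕ → LaurentTZ p r n)
    (s : ℕ) : matA e Δ Λ (s + 1) s = 1 := by
  rw [matA, esum_self, W_succ_self, hasseWitt_one]

theorem matA_mem_supportSubring {E : AddSubmonoid (Fin n → ℤ)} (e : ℕ → ℕ)
    (Δ : ℕ → Fin g ↪ (Fin r → ℤ)) {Λ : ℕ → LaurentTZ p r n}
    (hΛ : ∀ l, Λ l ∈ supportSubring (E.comap (AddMonoidHom.snd (Fin r → ℤ) (Fin n → ℤ))))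
    (i s : ℕ) (u v : Fin g) : matA e Δ Λ i s u v ∈ supportSubring E :=
  hasseWitt_mem_supportSubring (W_mem_supportSubring e hΛ i s) _ _ _ _ _

theorem matA_eq_sum_ghost {e : ℕ → ℕ} {Δ : ℕ → Fin g ↪ (Fin r → ℤ)} {Λ : ℕ → LaurentTZ p r n}
    (hadm : Admissible e Δ Λ) {i s : ℕ} (his : i ≤ s) :
    matA e Δ Λ i s = ∑ j ∈ Finset.Icc i s,
      hasseWitt (esum e i (j + 1)) (Δ i) (Δ (j + 1)) (ghost e Λ i j) *
        (matA e Δ Λ (j + 1) s).map (sigma (esum e i (j + 1))) := by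
  rw [matA, W_eq_sum_ghost e Λ his, hasseWitt_sum]
  refine Finset.sum_congr rfl fun j hj => ?_
  have hj' := Finset.mem_Icc.1 hj
  rw [← esum_add e (show i ≤ j + 1 by omega) (show j + 1 ≤ s + 1 by omega)]
  refine hasseWitt_mul_frob _ _ _ _ _ _ _ fun k hk u y hy => ?_
  -- Admissibility for the pair `(i, j)` applies because the ghost term has the Newton polytope
  -- bound of `W_j^{(i)}`.
  refine hadm i j hj'.1 y (Set.mem_add.2 ⟨_, ⟨u, rfl⟩, _, suppIn_ghost e Λ i j k hk, ?_⟩)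
  ext a
  have := congrFun hy a
  simp only [Pi.add_apply, Pi.smul_apply, nsmul_eq_mul] at this
  have h2 : ((k.1 a : ℤ) : ℝ) + (Δ i u a : ℝ) = (p : ℝ) ^ esum e i (j + 1) * (y a : ℝ) := by
    exact_mod_cast this
  rw [← h2, Pi.add_apply, add_comm]
  rfl

/-- The expansion of the Hasse–Witt matrices in terms of their Frobenius twists. -/
theorem exists_matA_expansion {e : ℕ → ℕ} {Δ : ℕ → Fin g ↪ (Fin r → ℤ)}
    {Λ : ℕ → LaurentTZ p r n} (he : ∀ l, 0 < e (l + 1)) (hadm : Admissible e Δ Λ)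
    {E : AddSubmonoid (Fin n → ℤ)}
    (hΛ : ∀ l, Λ l ∈ supportSubring (E.comap (AddMonoidHom.snd (Fin r → ℤ) (Fin n → ℤ)))) :
    ∃ B : ℕ → ℕ → Matrix (Fin g) (Fin g) (LaurentZ p n),
      (∀ i j u v, B i j u v ∈ supportSubring E) ∧
      (∀ i, B i i = hasseWitt (e (i + 1)) (Δ i) (Δ (i + 1)) (Λ i)) ∧
      ∀ i s, i ≤ s → matA e Δ Λ i s = ∑ j ∈ Finset.Icc i s,
        (p ^ (j - i) : ℕ) • (B i j * (matA e Δ Λ (j + 1) s).map (sigma (esum e i (j + 1)))) := by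
  choose H hH using prime_pow_dvd_ghost he Λ
  refine ⟨fun i j => hasseWitt (esum e i (j + 1)) (Δ i) (Δ (j + 1)) (H i j), ?_, ?_, ?_⟩
  · intro i j u v
    refine hasseWitt_mem_supportSubring ?_ _ _ _ _ _
    rw [← prime_pow_mul_mem_supportSubring_iff (j - i), ← hH]
    exact ghost_mem_supportSubring e hΛ i j
  · intro i
    have := hH i i
    rw [ghost_self, Nat.sub_self, pow_zero, one_mul] at this
    dsimp only
    rw [esum_succ_self, ← this]
  · intro i s his
    rw [matA_eq_sum_ghost hadm his]
    refine Finset.sum_congr rfl fun j _ => ?_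
    rw [hH i j, hasseWitt_prime_pow_mul, smul_mul_assoc]

end HasseWitt

/-! ### Congruences in noncommutative rings and the Dwork congruences -/

section Congruences

variable {R : Type*} [Ring R]

theorem natCast_dvd_mul_left {c : ℕ} {x : R} (h : (c : R) ∣ x) (y : R) : (c : R) ∣ y * x := by
  obtain ⟨z, rfl⟩ := h
  exact ⟨y * z, by rw [← mul_assoc, ← mul_assoc, (Nat.cast_commute c y).eq]⟩

theorem natCast_dvd_mul_sub_mul {c : ℕ} {x x' y y' : R} (hx : (c : R) ∣ x - x')
    (hy : (c : R) ∣ y - y') : (c : R) ∣ x * y - x' * y' := by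
  have : x * y - x' * y' = (x - x') * y + x' * (y - y') := by noncomm_ring
  rw [this]
  exact dvd_add (hx.mul_right y) (natCast_dvd_mul_left hy x')

theorem natCast_dvd_inv_sub_inv {c : ℕ} {x y : Rˣ} (h : (c : R) ∣ (x : R) - y) :
    (c : R) ∣ ((x⁻¹ : Rˣ) : R) - (y⁻¹ : Rˣ) := by
  have : ((x⁻¹ : Rˣ) : R) - (y⁻¹ : Rˣ) = -((x⁻¹ : Rˣ) * (((x : R) - y) * (y⁻¹ : Rˣ))) := by
    rw [sub_mul, Units.mul_inv, mul_sub, ← mul_assoc, Units.inv_mul, one_mul, mul_one, neg_sub]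
  rw [this, dvd_neg]
  exact natCast_dvd_mul_left (h.mul_right _) _

theorem natCast_pow_dvd_of_le {p k l : ℕ} (h : k ≤ l) {x : R} (hx : ((p ^ l : ℕ) : R) ∣ x) :
    ((p ^ k : ℕ) : R) ∣ x :=
  (Nat.cast_dvd_cast (pow_dvd_pow p h)).trans hx

/-- The Dwork congruences for the ratios of successive members of a family of units that satisfy
a triangular system of relations. -/
theorem prime_pow_dvd_ratio_sub {p : ℕ} {M : ℕ → ℕ → Rˣ} {b : ℕ → ℕ → R}
    (hM : ∀ i s, i ≤ s → (M i s : R) =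
      ∑ j ∈ Finset.Icc i s, (p ^ (j - i) : ℕ) • (b i j * (M (j + 1) s : R)))
    {i s : ℕ} (his : i ≤ s) :
    ((p ^ (s + 1 - i) : ℕ) : R) ∣
      ((M i (s + 1) * (M (i + 1) (s + 1))⁻¹ : Rˣ) : R) - (M i s * (M (i + 1) s)⁻¹ : Rˣ) := by
  obtain ⟨d, hd⟩ := Nat.exists_eq_add_of_le his
  -- The induction is on `d = s - i` with `s` fixed: the claim for `i` uses the claims for larger
  -- first indices.
  induction d using Nat.strong_induction_on generalizing i with
  | _ d ih =>
    -- Ratios of non-adjacent members, obtained by multiplying adjacent ones. Only modulus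
    -- `p^{s+1-j}` is available, and only that is needed, as the coefficient `p^{j-i}` supplies the
    -- rest.
    have hT : ∀ j, i ≤ j → j ≤ s → ((p ^ (s + 1 - j) : ℕ) : R) ∣
        ((M (j + 1) (s + 1) * (M (i + 1) (s + 1))⁻¹ : Rˣ) : R) -
          (M (j + 1) s * (M (i + 1) s)⁻¹ : Rˣ) := by
      intro j hij
      induction j, hij using Nat.le_induction with
      | base => simp
      | succ j hij hj =>
        intro hjs
        -- Uses `M_{j+2} M_{i+1}⁻¹ = (M_{j+1} M_{j+2}⁻¹)⁻¹ (M_{j+1} M_{i+1}⁻¹)`.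
        have h1 := natCast_dvd_inv_sub_inv (ih (s - (j + 1)) (by omega) hjs (by omega))
        have h2 := natCast_pow_dvd_of_le (show s + 1 - (j + 1) ≤ s + 1 - j by omega)
          (hj (by omega))
        have h3 := natCast_dvd_mul_sub_mul h1 h2
        simp only [← Units.val_mul] at h3
        simpa [mul_assoc] using h3
    simp only [Units.val_mul]
    rw [hM i (s + 1) (by omega), hM i s his, Finset.sum_mul, Finset.sum_mul,
      Finset.sum_Icc_succ_top (by omega), add_sub_right_comm, ← Finset.sum_sub_distrib]
    refine dvd_add (Finset.dvd_sum fun j hj => ?_) ?_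
    · have hj' := Finset.mem_Icc.1 hj
      obtain ⟨z, hz⟩ := natCast_dvd_mul_left (hT j hj'.1 hj'.2) (b i j)
      refine ⟨z, ?_⟩
      have hpow : p ^ (s + 1 - i) = p ^ (j - i) * p ^ (s + 1 - j) := by
        rw [← pow_add]
        congr 1
        omega
      rw [hpow, Nat.cast_mul, mul_assoc, ← hz, smul_mul_assoc, smul_mul_assoc, ← smul_sub,
        nsmul_eq_mul, mul_assoc, mul_assoc, ← mul_sub, Units.val_mul, Units.val_mul]
    -- The term `j = s + 1` has no counterpart at level `s`, but carries the factor `p^{s+1-i}`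
    -- itself.
    · rw [smul_mul_assoc, nsmul_eq_mul]
      exact dvd_mul_right _ _

/-- Determinants commute with passage to the quotient by `c`. -/
theorem dvd_det_sub_det {A ι : Type*} [CommRing A] [Fintype ι] [DecidableEq ι] {c : A}
    {X Y : Matrix ι ι A} (h : ∀ u v, c ∣ X u v - Y u v) : c ∣ X.det - Y.det := by
  rw [← Ideal.mem_span_singleton, ← Ideal.Quotient.eq, RingHom.map_det, RingHom.map_det]
  congr 1
  ext1 u v
  exact Ideal.Quotient.eq.2 (Ideal.mem_span_singleton.2 (h u v))

end Congruences

/-! ### Determinants modulo `p` -/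

section Determinants

variable {p : ℕ} [Fact p.Prime] {r n g : ℕ}

theorem nonzeroModP_iff (G : LaurentZ p n) :
    NonzeroModP G ↔ AddMonoidAlgebra.mapRingHom (Fin n → ℤ) (PadicInt.toZMod (p := p)) G ≠ 0 := by
  have h : ∀ d, (AddMonoidAlgebra.mapRingHom (Fin n → ℤ) (PadicInt.toZMod (p := p)) G).coeff d = 0
      ↔ (p : ℤ_[p]) ∣ G.coeff d := by
    intro d
    rw [AddMonoidAlgebra.coeff_mapRingHom, ← RingHom.mem_ker, PadicInt.ker_toZMod,
      PadicInt.maximalIdeal_eq_span_p, Ideal.mem_span_singleton]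
  constructor
  · rintro ⟨d, hd⟩ h0
    exact hd ((h d).1 (by rw [h0]; rfl))
  · intro h0
    by_contra hG
    refine h0 (AddMonoidAlgebra.ext (Finsupp.ext fun d => ?_))
    by_contra hd
    exact hG ⟨d, fun h' => hd ((h d).2 h')⟩

/-- The Laurent polynomial ring over `𝔽_p` is a domain. -/
theorem NonzeroModP.mul {F G : LaurentZ p n} (hF : NonzeroModP F) (hG : NonzeroModP G) :
    NonzeroModP (F * G) := by
  rw [nonzeroModP_iff] at *
  rw [map_mul]
  exact mul_ne_zero hF hG

theorem NonzeroModP.of_dvd_sub {F G : LaurentZ p n} (hG : NonzeroModP G)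
    (h : (p : LaurentZ p n) ∣ F - G) : NonzeroModP F := by
  obtain ⟨H, hH⟩ := h
  rw [nonzeroModP_iff] at *
  rw [sub_eq_iff_eq_add.1 hH, map_add, map_mul, map_natCast, AddMonoidAlgebra.natCast_def,
    CharP.cast_eq_zero, AddMonoidAlgebra.single_zero, zero_mul, zero_add]
  exact hG

theorem nonzeroModP_one : NonzeroModP (1 : LaurentZ p n) := by
  rw [nonzeroModP_iff, map_one]
  exact one_ne_zero

theorem NonzeroModP.frob {F : LaurentZ p n} (hF : NonzeroModP F) (k : ℕ) :
    NonzeroModP (frob k F) := by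
  obtain ⟨d, hd⟩ := hF
  have hp : p.Prime := Fact.out
  refine ⟨(p ^ k) • d, ?_⟩
  have : (Dwork.frob k F).coeff ((p ^ k) • d) = F.coeff d :=
    Finsupp.mapDomain_apply (smul_right_injective (Fin n → ℤ) (pow_pos hp.pos k).ne') _ _
  rwa [this]

/-- Modulo `p` only the term `j = i` of the expansion survives, and its coefficient matrix is the
one whose determinant is `basicDet`. -/
theorem prime_dvd_det_matA_sub {e : ℕ → ℕ} {Δ : ℕ → Fin g ↪ (Fin r → ℤ)}
    {Λ : ℕ → LaurentTZ p r n} (he : ∀ l, 0 < e (l + 1)) (hadm : Admissible e Δ Λ)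
    {i s : ℕ} (his : i ≤ s) :
    (p : LaurentZ p n) ∣ (matA e Δ Λ i s).det -
      basicDet e Δ Λ i * frob (e (i + 1)) (matA e Δ Λ (i + 1) s).det := by
  obtain ⟨B, -, hB, hexp⟩ := exists_matA_expansion he hadm (E := ⊤) (fun l d _ => trivial)
  rw [basicDet, RingHom.map_det, ← Matrix.det_mul]
  refine dvd_det_sub_det fun u v => ?_
  rw [hexp i s his, ← Finset.add_sum_Ioc_eq_sum_Icc his, Nat.sub_self, pow_zero, one_smul, hB,
    esum_succ_self, ← Matrix.sub_apply, sigma_eq_frob]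
  change _ ∣ (hasseWitt (e (i + 1)) (Δ i) (Δ (i + 1)) (Λ i) *
    (matA e Δ Λ (i + 1) s).map (frob (e (i + 1))) + _ -
    hasseWitt (e (i + 1)) (Δ i) (Δ (i + 1)) (Λ i) *
    (matA e Δ Λ (i + 1) s).map (frob (e (i + 1)))) u v
  rw [add_sub_cancel_left, Matrix.sum_apply]
  refine Finset.dvd_sum fun j hj => ?_
  obtain ⟨c, hc⟩ : p ∣ p ^ (j - i) := dvd_pow_self p (by have := Finset.mem_Ioc.1 hj; omega)
  rw [hc, Matrix.smul_apply, nsmul_eq_mul, Nat.cast_mul, mul_assoc]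
  exact dvd_mul_right _ _

theorem nonzeroModP_det_matA {e : ℕ → ℕ} {Δ : ℕ → Fin g ↪ (Fin r → ℤ)}
    {Λ : ℕ → LaurentTZ p r n} (he : ∀ l, 0 < e (l + 1)) (hadm : Admissible e Δ Λ)
    (hnd : Nondegenerate e Δ Λ) {i s : ℕ} (his : i ≤ s + 1) :
    NonzeroModP (matA e Δ Λ i s).det := by
  -- Descent on `i` from `i = s + 1`, where the product is empty and the matrix is the identity.
  induction his using Nat.decreasingInduction with
  | self =>
    rw [matA_succ_self, Matrix.det_one]
    exact nonzeroModP_one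
  | of_succ k hk ih =>
    exact ((hnd k).mul (ih.frob _)).of_dvd_sub (prime_dvd_det_matA_sub he hadm (by omega))

end Determinants

/-! ### Evaluation at integral points -/

section Evaluation

variable {p : ℕ} [Fact p.Prime] {r n g m : ℕ}

/-- The exponents that are negative only at places in `I`. -/
def negOn (I : Set (Fin n)) : AddSubmonoid (Fin n → ℤ) where
  carrier := {d | ∀ i, i ∉ I → 0 ≤ d i}
  add_mem' := fun hx hy i hi => add_nonneg (hx i hi) (hy i hi)
  zero_mem' := fun _ _ => le_rfl

theorem evalAt_eq_sum (a : Fin n → Qpm p m) (G : LaurentZ p n) :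
    evalAt a G = G.coeff.sum fun d c =>
      algebraMap ℚ_[p] (Qpm p m) (c : ℚ_[p]) * ∏ i, a i ^ (d i) := rfl

theorem evalAt_add (a : Fin n → Qpm p m) (F G : LaurentZ p n) :
    evalAt a (F + G) = evalAt a F + evalAt a G := by
  simp only [evalAt_eq_sum, AddMonoidAlgebra.coeff_add]
  exact Finsupp.sum_add_index' (by simp) (by intros; simp [add_mul])

theorem evalAt_single (a : Fin n → Qpm p m) (d : Fin n → ℤ) (c : ℤ_[p]) :
    evalAt a (AddMonoidAlgebra.single d c) =
      algebraMap ℚ_[p] (Qpm p m) (c : ℚ_[p]) * ∏ i, a i ^ (d i) := by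
  rw [evalAt_eq_sum, AddMonoidAlgebra.coeff_single, Finsupp.sum_single_index]
  simp

theorem evalAt_sum {ι : Type*} (a : Fin n → Qpm p m) (s : Finset ι) (f : ι → LaurentZ p n) :
    evalAt a (∑ i ∈ s, f i) = ∑ i ∈ s, evalAt a (f i) :=
  map_sum (AddMonoidHom.mk' (evalAt a) (evalAt_add a)) f s

/-- Integer powers are additive in the exponent only away from `0` or for nonnegative exponents.
Coordinates in `I` are nonzero, and the others carry nonnegative exponents. -/
theorem evalAt_mul {I : Set (Fin n)} {a : Fin n → Qpm p m} (ha : ∀ i ∈ I, ‖a i‖ = 1)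
    {F G : LaurentZ p n} (hF : F ∈ supportSubring (negOn I)) (hG : G ∈ supportSubring (negOn I)) :
    evalAt a (F * G) = evalAt a F * evalAt a G := by
  have hexp : ∀ H : LaurentZ p n,
      H = ∑ d ∈ H.coeff.support, AddMonoidAlgebra.single d (H.coeff d) :=
    fun H => (AddMonoidAlgebra.sum_coeff_single H).symm
  conv_lhs => rw [hexp F, hexp G]
  rw [Finset.sum_mul_sum, evalAt_sum]
  simp only [evalAt_sum]
  rw [evalAt, evalAt, Finset.sum_mul_sum]
  refine Finset.sum_congr rfl fun d hd => Finset.sum_congr rfl fun d' hd' => ?_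
  rw [AddMonoidAlgebra.single_mul_single, evalAt_single, PadicInt.coe_mul, map_mul,
    mul_mul_mul_comm, ← Finset.prod_mul_distrib]
  congr 1
  refine Finset.prod_congr rfl fun i _ => ?_
  rw [Pi.add_apply]
  by_cases hi : i ∈ I
  · have : a i ≠ 0 := by
      rw [← norm_ne_zero_iff, ha i hi]
      exact one_ne_zero
    exact zpow_add₀ this _ _
  · obtain ⟨x, hx⟩ := Int.eq_ofNat_of_zero_le (hF d (Finsupp.mem_support_iff.1 hd) i hi)
    obtain ⟨y, hy⟩ := Int.eq_ofNat_of_zero_le (hG d' (Finsupp.mem_support_iff.1 hd') i hi)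
    rw [hx, hy, ← Nat.cast_add, zpow_natCast, zpow_natCast, zpow_natCast, pow_add]

/-- Evaluation at `a` as a ring homomorphism. -/
def evalHom {I : Set (Fin n)} {a : Fin n → Qpm p m} (ha : ∀ i ∈ I, ‖a i‖ = 1) :
    supportSubring (p := p) (negOn I) →+* Qpm p m where
  toFun G := evalAt a G.1
  map_one' := by
    change evalAt a 1 = 1
    rw [AddMonoidAlgebra.one_def, evalAt_single]
    simp
  map_mul' F G := evalAt_mul ha F.2 G.2
  map_zero' := by
    change evalAt a 0 = 0
    simp [evalAt]
  map_add' F G := evalAt_add a F.1 G.1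

theorem evalHom_apply {I : Set (Fin n)} {a : Fin n → Qpm p m} (ha : ∀ i ∈ I, ‖a i‖ = 1)
    (G : supportSubring (p := p) (negOn I)) : evalHom ha G = evalAt a G.1 := rfl

theorem evalAt_pow {I : Set (Fin n)} {a : Fin n → Qpm p m} (ha : ∀ i ∈ I, ‖a i‖ = 1)
    {F : LaurentZ p n} (hF : F ∈ supportSubring (negOn I)) (k : ℕ) :
    evalAt a (F ^ k) = evalAt a F ^ k := by
  have h := map_pow (evalHom ha) ⟨F, hF⟩ k
  rwa [evalHom_apply, evalHom_apply, SubmonoidClass.coe_pow] at h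

theorem norm_algebraMap_padicInt_le (c : ℤ_[p]) :
    ‖algebraMap ℚ_[p] (Qpm p m) (c : ℚ_[p])‖ ≤ 1 := by
  rw [norm_algebraMap']
  exact c.2

theorem norm_evalAt_le {I : Set (Fin n)} {a : Fin n → Qpm p m} (ha1 : ∀ i, ‖a i‖ ≤ 1)
    (ha : ∀ i ∈ I, ‖a i‖ = 1) {F : LaurentZ p n} (hF : F ∈ supportSubring (negOn I)) :
    ‖evalAt a F‖ ≤ 1 := by
  refine IsUltrametricDist.norm_sum_le_of_forall_le_of_nonneg zero_le_one fun d hd => ?_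
  rw [norm_mul, norm_prod]
  refine mul_le_one₀ (norm_algebraMap_padicInt_le _)
    (Finset.prod_nonneg fun _ _ => norm_nonneg _)
    (Finset.prod_le_one (fun _ _ => norm_nonneg _) fun i _ => ?_)
  by_cases hi : i ∈ I
  · rw [norm_zpow, ha i hi, one_zpow]
  · obtain ⟨x, hx⟩ := Int.eq_ofNat_of_zero_le (hF d (Finsupp.mem_support_iff.1 hd) i hi)
    rw [hx, zpow_natCast, norm_pow]
    exact pow_le_one₀ (norm_nonneg _) (ha1 i)

theorem norm_natCast_prime_Qpm : ‖(p : Qpm p m)‖ = (p : ℝ)⁻¹ := by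
  rw [← map_natCast (algebraMap ℚ_[p] (Qpm p m)), norm_algebraMap', Padic.norm_p]

/-- The quotient `(F - G) / p` has the same admissible exponents, so its value is integral and the
difference has norm at most `1/p`. -/
theorem norm_evalAt_sub_lt {I : Set (Fin n)} {a : Fin n → Qpm p m} (ha1 : ∀ i, ‖a i‖ ≤ 1)
    (ha : ∀ i ∈ I, ‖a i‖ = 1) {F G : LaurentZ p n} (hF : F ∈ supportSubring (negOn I))
    (hG : G ∈ supportSubring (negOn I)) (h : (p : LaurentZ p n) ∣ F - G) :
    ‖evalAt a F - evalAt a G‖ < 1 := by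
  have hp : p.Prime := Fact.out
  obtain ⟨H, hH⟩ := h
  have hFG : (p : LaurentZ p n) ^ 1 * H ∈ supportSubring (negOn I) := by
    rw [pow_one, ← hH]
    exact Subring.sub_mem _ hF hG
  have hH' := (prime_pow_mul_mem_supportSubring_iff 1).1 hFG
  have h1 : evalAt a F - evalAt a G = p * evalAt a H := by
    have hp' : evalAt a (p : LaurentZ p n) = p := map_natCast (evalHom ha) p
    rw [sub_eq_iff_eq_add.1 hH, evalAt_add, add_sub_cancel_right,
      evalAt_mul ha (natCast_mem _ p) hH', hp']
  rw [h1, norm_mul, norm_natCast_prime_Qpm]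
  have : (p : ℝ)⁻¹ < 1 := inv_lt_one_of_one_lt₀ (by exact_mod_cast hp.one_lt)
  have h2 := norm_evalAt_le ha1 ha hH'
  have h0 : (0 : ℝ) ≤ (p : ℝ)⁻¹ := by positivity
  nlinarith

theorem norm_eq_one_of_sub_lt {K : Type*} [NormedField K] [IsUltrametricDist K] {x y : K}
    (hy : ‖y‖ = 1) (h : ‖x - y‖ < 1) : ‖x‖ = 1 := by
  have h1 : ‖x - y‖ ≠ ‖y‖ := by rw [hy]; exact h.ne
  have := IsUltrametricDist.norm_add_eq_max_of_norm_ne_norm h1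
  rwa [sub_add_cancel, hy, max_eq_right h.le] at this

/-- The value of `φ^k F` at `a` is congruent to `F(a)^{p^k}`, so no information about `F` at
`a^{p^k}` is needed. -/
theorem norm_evalAt_frob {I : Set (Fin n)} {a : Fin n → Qpm p m} (ha1 : ∀ i, ‖a i‖ ≤ 1)
    (ha : ∀ i ∈ I, ‖a i‖ = 1) {F : LaurentZ p n} (hF : F ∈ supportSubring (negOn I))
    (h : ‖evalAt a F‖ = 1) (k : ℕ) : ‖evalAt a (frob k F)‖ = 1 := by
  have h1 := norm_evalAt_sub_lt ha1 ha (frob_mem_supportSubring k hF)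
    (Subring.pow_mem _ hF (p ^ k)) ((dvd_sub_comm).1 (prime_dvd_pow_sub_frob k F))
  refine norm_eq_one_of_sub_lt ?_ h1
  rw [evalAt_pow ha hF, norm_pow, h, one_pow]

theorem det_mem_subring {A ι : Type*} [CommRing A] [Fintype ι] [DecidableEq ι] {S : Subring A}
    {X : Matrix ι ι A} (h : ∀ u v, X u v ∈ S) : X.det ∈ S := by
  rw [Matrix.det_apply]
  exact Subring.sum_mem _ fun σ _ => by
    rw [Units.smul_def]
    exact Subring.zsmul_mem _ (Subring.prod_mem _ fun i _ => h _ _) _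

theorem norm_evalAt_det_matA {e : ℕ → ℕ} {Δ : ℕ → Fin g ↪ (Fin r → ℤ)}
    {Λ : ℕ → LaurentTZ p r n} (he : ∀ l, 0 < e (l + 1)) (hadm : Admissible e Δ Λ)
    {I : Set (Fin n)}
    (hΛ : ∀ l, Λ l ∈ supportSubring ((negOn I).comap (AddMonoidHom.snd (Fin r → ℤ) (Fin n → ℤ))))
    {a : Fin n → Qpm p m} (ha1 : ∀ i, ‖a i‖ ≤ 1) (ha : ∀ i ∈ I, ‖a i‖ = 1)
    (had : ∀ l, ‖evalAt a (basicDet e Δ Λ l)‖ = 1) {i s : ℕ} (his : i ≤ s + 1) :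
    ‖evalAt a (matA e Δ Λ i s).det‖ = 1 := by
  have hmem : ∀ i s, (matA e Δ Λ i s).det ∈ supportSubring (negOn I) := fun i s =>
    det_mem_subring (matA_mem_supportSubring e Δ hΛ i s)
  have hd : ∀ i, basicDet e Δ Λ i ∈ supportSubring (negOn I) := fun i =>
    det_mem_subring (hasseWitt_mem_supportSubring (hΛ i) _ _ _)
  induction his using Nat.decreasingInduction with
  | self =>
    rw [matA_succ_self, Matrix.det_one]
    have : evalAt a (1 : LaurentZ p n) = 1 := map_one (evalHom ha)
    rw [this, norm_one]
  | of_succ k hk ih =>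
    have h1 := norm_evalAt_sub_lt ha1 ha (hmem k s)
      (Subring.mul_mem _ (hd k) (frob_mem_supportSubring (e (k + 1)) (hmem (k + 1) s)))
      (prime_dvd_det_matA_sub he hadm (by omega))
    refine norm_eq_one_of_sub_lt ?_ h1
    rw [evalAt_mul ha (hd k) (frob_mem_supportSubring _ (hmem _ _)), norm_mul, had,
      norm_evalAt_frob ha1 ha (hmem _ _) ih, mul_one]

end Evaluation

/-! ### Power series with integral coefficients on the open unit polydisc -/

section IntegralPowerSeries

variable (K : Type*) [NontriviallyNormedField K] [IsUltrametricDist K]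

/-- The closed unit ball of a nonarchimedean field, as a subring. -/
def integers : Subring K where
  carrier := {x | ‖x‖ ≤ 1}
  mul_mem' := fun {x y} hx hy => by
    change ‖x * y‖ ≤ 1
    rw [norm_mul]
    exact mul_le_one₀ hx (norm_nonneg _) hy
  one_mem' := norm_one.le
  add_mem' := fun {x y} hx hy => (IsUltrametricDist.norm_add_le_max x y).trans (max_le hx hy)
  zero_mem' := by simp
  neg_mem' := fun {x} hx => by
    change ‖-x‖ ≤ 1
    rwa [norm_neg]

variable {K} {n : ℕ}

theorem norm_integers_le (x : integers K) : ‖(x : K)‖ ≤ 1 := x.2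

theorem isUnit_integers_iff (x : integers K) : IsUnit x ↔ ‖(x : K)‖ = 1 := by
  constructor
  · rintro ⟨u, rfl⟩
    have h : (u : K) * ((u⁻¹ : (integers K)ˣ) : integers K) = 1 := by
      rw [← Subring.coe_mul, Units.mul_inv, Subring.coe_one]
    have h' := congrArg norm h
    rw [norm_mul, norm_one] at h'
    have h1 := norm_integers_le (u : integers K)
    have h2 := norm_integers_le ((u⁻¹ : (integers K)ˣ) : integers K)
    have h3 := norm_nonneg (u : K)
    nlinarith
  · intro h
    have h0 : (x : K) ≠ 0 := by
      rw [← norm_ne_zero_iff, h]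
      exact one_ne_zero
    refine IsUnit.of_mul_eq_one ⟨(x : K)⁻¹, ?_⟩ (Subtype.ext (mul_inv_cancel₀ h0))
    change ‖(x : K)⁻¹‖ ≤ 1
    rw [norm_inv, h, inv_one]

theorem summable_prod_pow {ρ : ℝ} (h0 : 0 ≤ ρ) (h1 : ρ < 1) (n : ℕ) :
    Summable fun d : Fin n → ℕ => ∏ i, ρ ^ d i := by
  induction n with
  | zero => exact Summable.of_finite
  | succ n ih =>
    rw [← (Fin.consEquiv fun _ => ℕ).summable_iff]
    have := (summable_geometric_of_lt_one h0 h1).mul_of_nonneg ih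
      (fun _ => pow_nonneg h0 _) (fun d => Finset.prod_nonneg fun _ _ => pow_nonneg h0 _)
    refine this.congr fun d => ?_
    simp [Fin.prod_univ_succ, Fin.consEquiv]

theorem summable_prod_pow_finsupp {ρ : ℝ} (h0 : 0 ≤ ρ) (h1 : ρ < 1) (n : ℕ) :
    Summable fun d : Fin n →₀ ℕ => ∏ i, ρ ^ d i :=
  (summable_prod_pow h0 h1 n).comp_injective
    (i := fun d : Fin n →₀ ℕ => (d : Fin n → ℕ)) DFunLike.coe_injective

omit [IsUltrametricDist K] in
theorem norm_prod_pow_le (w : Fin n → K) (d : Fin n →₀ ℕ) :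
    ‖∏ i, w i ^ d i‖ ≤ ∏ i, ‖w‖ ^ d i := by
  rw [norm_prod]
  refine Finset.prod_le_prod (fun _ _ => norm_nonneg _) fun i _ => ?_
  rw [norm_pow]
  exact pow_le_pow_left₀ (norm_nonneg _) (norm_le_pi_norm w i) _

/-- The terms of a power series. -/
def psTerm (c : MvPowerSeries (Fin n) (integers K)) (w : Fin n → K) (d : Fin n →₀ ℕ) : K :=
  ((MvPowerSeries.coeff d c : integers K) : K) * ∏ i, w i ^ d i

theorem norm_psTerm_le (c : MvPowerSeries (Fin n) (integers K)) (w : Fin n → K) (d : Fin n →₀ ℕ) :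
    ‖psTerm c w d‖ ≤ ∏ i, ‖w‖ ^ d i := by
  rw [psTerm, norm_mul]
  exact (mul_le_of_le_one_left (norm_nonneg _) (norm_integers_le _)).trans (norm_prod_pow_le w d)

theorem summable_norm_psTerm {w : Fin n → K} (hw : ‖w‖ < 1)
    (c : MvPowerSeries (Fin n) (integers K)) : Summable fun d => ‖psTerm c w d‖ :=
  Summable.of_nonneg_of_le (fun _ => norm_nonneg _) (norm_psTerm_le c w)
    (summable_prod_pow_finsupp (norm_nonneg w) hw n)

theorem psTerm_add (c c' : MvPowerSeries (Fin n) (integers K)) (w : Fin n → K) (d : Fin n →₀ ℕ) :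
    psTerm (c + c') w d = psTerm c w d + psTerm c' w d := by
  rw [psTerm, map_add, Subring.coe_add, add_mul]
  rfl

theorem psTerm_mul (c c' : MvPowerSeries (Fin n) (integers K)) (w : Fin n → K) (d : Fin n →₀ ℕ) :
    psTerm (c * c') w d =
      ∑ x ∈ Finset.HasAntidiagonal.antidiagonal d, psTerm c w x.1 * psTerm c' w x.2 := by
  rw [psTerm, MvPowerSeries.coeff_mul, AddSubmonoidClass.coe_finsetSum, Finset.sum_mul]
  refine Finset.sum_congr rfl fun x hx => ?_
  rw [psTerm, psTerm, Subring.coe_mul, mul_mul_mul_comm, ← Finset.prod_mul_distrib]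
  congr 1
  refine Finset.prod_congr rfl fun i _ => ?_
  rw [← pow_add, ← Finset.HasAntidiagonal.mem_antidiagonal.1 hx, Finsupp.add_apply]

variable [CompleteSpace K]

theorem summable_psTerm {w : Fin n → K} (hw : ‖w‖ < 1)
    (c : MvPowerSeries (Fin n) (integers K)) : Summable (psTerm c w) :=
  (summable_norm_psTerm hw c).of_norm

/-- The value at `w` of a power series with integral coefficients. -/
def psEval {w : Fin n → K} (hw : ‖w‖ < 1) : MvPowerSeries (Fin n) (integers K) →+* K where
  toFun c := ∑' d, psTerm c w d
  map_one' := by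
    classical
    rw [tsum_eq_single 0]
    · simp [psTerm]
    · intro d hd
      simp [psTerm, MvPowerSeries.coeff_one, hd]
  map_zero' := by simp [psTerm]
  map_add' c c' := by
    simp only [psTerm_add]
    exact (summable_psTerm hw c).tsum_add (summable_psTerm hw c')
  map_mul' c c' := by
    simp only [psTerm_mul]
    exact (Summable.tsum_mul_tsum_eq_tsum_sum_antidiagonal (summable_psTerm hw c)
      (summable_psTerm hw c') (summable_mul_of_summable_norm (summable_norm_psTerm hw c)
      (summable_norm_psTerm hw c'))).symm

theorem psEval_apply {w : Fin n → K} (hw : ‖w‖ < 1) (c : MvPowerSeries (Fin n) (integers K)) :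
    psEval hw c = ∑' d, psTerm c w d := rfl

theorem hasSum_psEval {w : Fin n → K} (hw : ‖w‖ < 1) (c : MvPowerSeries (Fin n) (integers K)) :
    HasSum (psTerm c w) (psEval hw c) :=
  (summable_psTerm hw c).hasSum

theorem norm_psEval_le {w : Fin n → K} (hw : ‖w‖ < 1)
    (c : MvPowerSeries (Fin n) (integers K)) : ‖psEval hw c‖ ≤ 1 := by
  refine le_of_tendsto (hasSum_psEval hw c).norm (Filter.Eventually.of_forall fun s => ?_)
  refine IsUltrametricDist.norm_sum_le_of_forall_le_of_nonneg zero_le_one fun d _ => ?_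
  exact (norm_psTerm_le c w d).trans
    (Finset.prod_le_one (fun _ _ => pow_nonneg (norm_nonneg _) _)
      fun _ _ => pow_le_one₀ (norm_nonneg _) hw.le)

theorem psEval_C {w : Fin n → K} (hw : ‖w‖ < 1) (x : integers K) :
    psEval hw (MvPowerSeries.C x) = x := by
  classical
  rw [psEval_apply, tsum_eq_single 0]
  · simp [psTerm]
  · intro d hd
    simp [psTerm, MvPowerSeries.coeff_C, hd]

theorem psEval_X {w : Fin n → K} (hw : ‖w‖ < 1) (i : Fin n) :
    psEval hw (MvPowerSeries.X i) = w i := by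
  classical
  rw [psEval_apply, tsum_eq_single (Finsupp.single i 1)]
  · rw [psTerm, MvPowerSeries.coeff_index_single_self_X, Finset.prod_eq_single i]
    · simp
    · intro j _ hj
      simp [Finsupp.single_eq_of_ne hj]
    · simp
  · intro d hd
    simp [psTerm, MvPowerSeries.coeff_X, hd]

theorem psEval_zero_point (h : ‖(0 : Fin n → K)‖ < 1) (c : MvPowerSeries (Fin n) (integers K)) :
    psEval h c = (MvPowerSeries.constantCoeff c : integers K) := by
  rw [psEval_apply, tsum_eq_single 0]
  · simp [psTerm]
  · intro d hd
    obtain ⟨i, hi⟩ := Finsupp.ne_iff.1 hd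
    rw [psTerm, Finset.prod_eq_zero (Finset.mem_univ i), mul_zero]
    rw [Pi.zero_apply, zero_pow hi]

/-- Sum coefficientwise: integrality survives because the unit ball is closed and ultrametric, and
the double sum is dominated by `‖π s‖ ∏ ‖w‖^{d_i}`, which permits the exchange. -/
theorem exists_psEval_tsum (π : ℕ → integers K) (hπ : Summable fun s => ‖(π s : K)‖)
    (c : ℕ → MvPowerSeries (Fin n) (integers K)) :
    ∃ C : MvPowerSeries (Fin n) (integers K), ∀ (w : Fin n → K) (hw : ‖w‖ < 1),
      psEval hw C = ∑' s, (π s : K) * psEval hw (c s) := by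
  have hsum : ∀ d, Summable fun s => (π s : K) * ((MvPowerSeries.coeff d (c s) : integers K) : K) := fun d => by
    refine Summable.of_norm (Summable.of_nonneg_of_le (fun _ => norm_nonneg _) (fun s => ?_) hπ)
    rw [norm_mul]
    exact mul_le_of_le_one_right (norm_nonneg _) (norm_integers_le _)
  have hle : ∀ d, ∑' s, (π s : K) * ((MvPowerSeries.coeff d (c s) : integers K) : K) ∈ integers K := fun d => by
    refine le_of_tendsto (hsum d).hasSum.norm (Filter.Eventually.of_forall fun t => ?_)
    exact IsUltrametricDist.norm_sum_le_of_forall_le_of_nonneg zero_le_one fun s _ =>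
      ((π s) * MvPowerSeries.coeff d (c s)).2
  refine ⟨fun d => ⟨_, hle d⟩, fun w hw => ?_⟩
  have hprod : Summable fun x : ℕ × (Fin n →₀ ℕ) =>
      (π x.1 : K) * psTerm (c x.1) w x.2 := by
    refine Summable.of_norm (Summable.of_nonneg_of_le (fun _ => norm_nonneg _) (fun x => ?_)
      (hπ.mul_of_nonneg (summable_prod_pow_finsupp (norm_nonneg w) hw n)
        (fun _ => norm_nonneg _)
        (fun d => Finset.prod_nonneg fun _ _ => pow_nonneg (norm_nonneg _) _)))
    rw [norm_mul]
    exact mul_le_mul_of_nonneg_left (norm_psTerm_le _ _ _) (norm_nonneg _)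
  have h1 := hprod.hasSum.prod_fiberwise fun s => (hasSum_psEval hw (c s)).mul_left (π s : K)
  refine Eq.trans ?_ h1.tsum_eq.symm
  refine HasSum.tsum_eq (((Equiv.prodComm (Fin n →₀ ℕ) ℕ).hasSum_iff.2
    hprod.hasSum).prod_fiberwise fun d => ?_)
  have := (hsum d).hasSum.mul_right (∏ i, w i ^ d i)
  simp only [mul_assoc] at this
  exact this

omit [IsUltrametricDist K] [CompleteSpace K] in
-- Lists the variables of a monomial with multiplicity, so that the monomial becomes a multilinear
-- form restricted to the diagonal.
theorem exists_index_of_degree (d : Fin n →₀ ℕ) :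
    ∃ idx : Fin d.degree → Fin n, ∀ x : Fin n → K, ∏ j, x (idx j) = ∏ i, x i ^ d i := by
  have hlen : (Finsupp.toMultiset d).toList.length = d.degree := by
    rw [Multiset.length_toList, Finsupp.card_toMultiset]
    rfl
  refine ⟨fun j => (Finsupp.toMultiset d).toList.get (j.cast hlen.symm), fun x => ?_⟩
  have h1 : ∏ j : Fin d.degree, x ((Finsupp.toMultiset d).toList.get (j.cast hlen.symm)) =
      ((Finsupp.toMultiset d).toList.map x).prod := by
    rw [← Fin.prod_univ_getElem, ← (finCongr (show d.degree =
      ((Finsupp.toMultiset d).toList.map x).length by rw [List.length_map, hlen])).prod_comp]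
    exact Finset.prod_congr rfl fun j _ => by simp
  rw [h1, ← Multiset.prod_coe, ← Multiset.map_coe, Multiset.coe_toList, Finsupp.toMultiset_map,
    Finsupp.prod_toMultiset, Finsupp.prod_mapDomain_index (by simp) (by intros; rw [pow_add]),
    Finsupp.prod_fintype _ _ (by simp)]

instance finite_degree_eq (n k : ℕ) : Finite {d : Fin n →₀ ℕ // d.degree = k} := by
  refine Set.Finite.subset (Finset.finite_toSet (Finset.finsuppAntidiag Finset.univ k))
    fun d hd => ?_
  rw [Finset.mem_coe, Finset.mem_finsuppAntidiag]
  refine ⟨?_, Finset.subset_univ _⟩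
  rw [← Finsupp.degree_eq_sum]
  exact hd

/-- A function given on the unit ball by a power series with integral coefficients is analytic on
the unit ball. -/
theorem exists_hasFPowerSeriesOnBall {f : (Fin n → K) → K} {a : Fin n → K}
    (c : MvPowerSeries (Fin n) (integers K))
    (hf : ∀ (w : Fin n → K) (hw : ‖w‖ < 1), f (a + w) = psEval hw c) :
    ∃ P : FormalMultilinearSeries K (Fin n → K) K, HasFPowerSeriesOnBall f P a 1 := by
  have hfin : ∀ k, Fintype {d : Fin n →₀ ℕ // d.degree = k} := fun k => Fintype.ofFinite _
  have hidx : ∀ (k : ℕ) (d : {d : Fin n →₀ ℕ // d.degree = k}),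
      ∃ idx : Fin k → Fin n, ∀ x : Fin n → K, ∏ j, x (idx j) = ∏ i, x i ^ d.1 i := by
    rintro k ⟨d, rfl⟩
    exact exists_index_of_degree d
  choose idx hidx using hidx
  let P : FormalMultilinearSeries K (Fin n → K) K := fun k =>
    ∑ d : {d : Fin n →₀ ℕ // d.degree = k}, ((MvPowerSeries.coeff d.1 c : integers K) : K) •
      (ContinuousMultilinearMap.mkPiAlgebra K (Fin k) K).compContinuousLinearMap
        fun j => ContinuousLinearMap.proj (R := K) (φ := fun _ : Fin n => K) (idx k d j)
  have hP : ∀ k (m : Fin k → Fin n → K), P k m =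
      ∑ d : {d : Fin n →₀ ℕ // d.degree = k},
        ((MvPowerSeries.coeff d.1 c : integers K) : K) * ∏ j, m j (idx k d j) := by
    intro k m
    simp [P, sum_apply]
  refine ⟨P, ?_, one_pos, fun {y} hy => ?_⟩
  -- By the ultrametric inequality each homogeneous part has operator norm at most `1`, hence the
  -- radius is at least `1`.
  · have h := P.le_radius_of_bound 1 (r := 1) fun k => ?_
    · simpa using h
    · rw [NNReal.coe_one, one_pow, mul_one]
      refine ContinuousMultilinearMap.opNorm_le_bound zero_le_one fun m => ?_
      rw [one_mul, hP]
      refine IsUltrametricDist.norm_sum_le_of_forall_le_of_nonneg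
        (Finset.prod_nonneg fun _ _ => norm_nonneg _) fun d _ => ?_
      rw [norm_mul]
      refine (mul_le_of_le_one_left (norm_nonneg _) (norm_integers_le _)).trans ?_
      rw [norm_prod]
      exact Finset.prod_le_prod (fun _ _ => norm_nonneg _) fun j _ => norm_le_pi_norm _ _
  · have hy' : ‖y‖ < 1 := by
      rw [Metric.mem_eball, edist_zero_right, ← ENNReal.coe_one, enorm_lt_coe] at hy
      exact_mod_cast hy
    rw [hf y hy']
    -- Regroups the sum over monomials by total degree.
    have h := (Equiv.sigmaFiberEquiv (fun d : Fin n →₀ ℕ => d.degree)).hasSum_iff.2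
      (hasSum_psEval hy' c)
    refine h.sigma fun k => ?_
    rw [hP]
    simp only [hidx]
    exact hasSum_fintype _

end IntegralPowerSeries

/-! ### The ring of integral analytic functions -/

section IntegralAnalytic

variable {K : Type*} [NontriviallyNormedField K] [IsUltrametricDist K] [CompleteSpace K] {n : ℕ}

/-- The ring of functions on `D` that are given, near each point of `D` (at distance less than
`1`), by a power series with integral coefficients. -/
def integralAnalytic (D : Set (Fin n → K)) : Subring (D → K) where
  carrier := {f | ∀ a : D, ∃ c : MvPowerSeries (Fin n) (integers K),
    ∀ (b : D) (h : ‖(b : Fin n → K) - a‖ < 1), f b = psEval h c}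
  mul_mem' := fun hf hf' a => by
    obtain ⟨c, hc⟩ := hf a
    obtain ⟨c', hc'⟩ := hf' a
    exact ⟨c * c', fun b h => by rw [map_mul, ← hc, ← hc', Pi.mul_apply]⟩
  one_mem' := fun a => ⟨1, fun b h => by rw [map_one, Pi.one_apply]⟩
  add_mem' := fun hf hf' a => by
    obtain ⟨c, hc⟩ := hf a
    obtain ⟨c', hc'⟩ := hf' a
    exact ⟨c + c', fun b h => by rw [map_add, ← hc, ← hc', Pi.add_apply]⟩
  zero_mem' := fun a => ⟨0, fun b h => by rw [map_zero, Pi.zero_apply]⟩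
  neg_mem' := fun hf a => by
    obtain ⟨c, hc⟩ := hf a
    exact ⟨-c, fun b h => by rw [map_neg, ← hc, Pi.neg_apply]⟩

/-- The type of integral analytic functions on `D`. -/
def IntegralAnalytic (D : Set (Fin n → K)) : Type _ := integralAnalytic D

instance (D : Set (Fin n → K)) : CommRing (IntegralAnalytic D) :=
  inferInstanceAs (CommRing (integralAnalytic D))

/-- Evaluation of a function at a point. -/
def evalPt {D : Set (Fin n → K)} (a : D) : IntegralAnalytic D →+* K :=
  (Pi.evalRingHom (fun _ : D => K) a).comp (integralAnalytic D).subtype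

namespace integralAnalytic

variable {D : Set (Fin n → K)}

omit [IsUltrametricDist K] [CompleteSpace K] in
theorem norm_sub_self_lt (a : D) : ‖(a : Fin n → K) - a‖ < 1 := by
  rw [sub_self, norm_zero]
  exact one_pos

theorem norm_le {f : D → K} (hf : f ∈ integralAnalytic D) (a : D) : ‖f a‖ ≤ 1 := by
  obtain ⟨c, hc⟩ := hf a
  rw [hc a (norm_sub_self_lt a)]
  exact norm_psEval_le _ _

/-- The constant coefficient is the value at the centre; having norm `1`, it is a unit, which makes
the whole series invertible with integral coefficients. -/
theorem exists_unit {f : D → K} (hf : f ∈ integralAnalytic D) {a : D} (ha : ‖f a‖ = 1) :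
    ∃ c : (MvPowerSeries (Fin n) (integers K))ˣ,
      ∀ (b : D) (h : ‖(b : Fin n → K) - a‖ < 1), f b = psEval h c := by
  obtain ⟨c, hc⟩ := hf a
  have hu : IsUnit c := by
    rw [MvPowerSeries.isUnit_iff_constantCoeff, isUnit_integers_iff, ← ha,
      hc a (norm_sub_self_lt a)]
    have h0 : ‖(0 : Fin n → K)‖ < 1 := by simp
    rw [← psEval_zero_point h0]
    simp only [sub_self]
  obtain ⟨u, rfl⟩ := hu
  exact ⟨u, hc⟩

theorem psEval_unit_mul_inv {w : Fin n → K} (hw : ‖w‖ < 1)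
    (c : (MvPowerSeries (Fin n) (integers K))ˣ) :
    psEval hw c * psEval hw (c⁻¹ : (MvPowerSeries (Fin n) (integers K))ˣ) = 1 := by
  rw [← map_mul, Units.mul_inv, map_one]

/-- The local series and its inverse both take values of norm at most `1`, with product `1`. -/
theorem norm_eq_one_of_near {f : D → K} (hf : f ∈ integralAnalytic D) {a b : D}
    (h : ‖(b : Fin n → K) - a‖ < 1) (ha : ‖f a‖ = 1) : ‖f b‖ = 1 := by
  obtain ⟨c, hc⟩ := exists_unit hf ha
  have h1 := congrArg norm (psEval_unit_mul_inv h c)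
  rw [norm_mul, norm_one, ← hc b h] at h1
  have h2 := norm_psEval_le h ((c⁻¹ : (MvPowerSeries (Fin n) (integers K))ˣ) :
    MvPowerSeries (Fin n) (integers K))
  have h3 := norm_le hf b
  have h4 := norm_nonneg (f b)
  nlinarith

theorem inv_mem {f : D → K} (hf : f ∈ integralAnalytic D) (h : ∀ a, ‖f a‖ = 1) :
    (fun a => (f a)⁻¹) ∈ integralAnalytic D := by
  intro a
  obtain ⟨c, hc⟩ := exists_unit hf (h a)
  refine ⟨(c⁻¹ : (MvPowerSeries (Fin n) (integers K))ˣ), fun b hb => ?_⟩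
  change (f b)⁻¹ = _
  rw [hc b hb]
  exact inv_eq_of_mul_eq_one_right (psEval_unit_mul_inv hb c)

theorem norm_evalPt_le (f : IntegralAnalytic D) (a : D) : ‖evalPt a f‖ ≤ 1 := norm_le f.2 a

theorem isUnit_of_norm_eq_one (f : IntegralAnalytic D) (h : ∀ a, ‖evalPt a f‖ = 1) :
    IsUnit f := by
  refine IsUnit.of_mul_eq_one ⟨_, inv_mem f.2 h⟩ (Subtype.ext (funext fun a => ?_))
  refine mul_inv_cancel₀ (norm_ne_zero_iff.1 ((h a).trans_ne ?_))
  exact one_ne_zero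

theorem const_mem {x : K} (hx : ‖x‖ ≤ 1) : (fun _ : D => x) ∈ integralAnalytic D := fun _ =>
  ⟨MvPowerSeries.C ⟨x, hx⟩, fun _ h => (psEval_C h ⟨x, hx⟩).symm⟩

theorem coord_mem (i : Fin n) (hD : ∀ a ∈ D, ‖a i‖ ≤ 1) :
    (fun a : D => (a : Fin n → K) i) ∈ integralAnalytic D := fun a =>
  ⟨MvPowerSeries.C ⟨a.1 i, hD a.1 a.2⟩ + MvPowerSeries.X i, fun b h => by
    rw [map_add, psEval_C, psEval_X, Pi.sub_apply, add_sub_cancel]⟩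

theorem tsum_mem {π : ℕ → K} (hπ1 : ∀ s, ‖π s‖ ≤ 1) (hπ : Summable fun s => ‖π s‖)
    {f : ℕ → D → K} (hf : ∀ s, f s ∈ integralAnalytic D) :
    (fun a => ∑' s, π s * f s a) ∈ integralAnalytic D := by
  intro a
  choose c hc using fun s => hf s a
  obtain ⟨C, hC⟩ := exists_psEval_tsum (fun s => (⟨π s, hπ1 s⟩ : integers K)) hπ c
  refine ⟨C, fun b hb => ?_⟩
  rw [hC]
  exact tsum_congr fun s => by rw [hc s b hb]

theorem exists_hasFPowerSeriesOnBall (f : IntegralAnalytic D)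
    {F : (Fin n → K) → K} (hF : ∀ b : D, F b = evalPt b f) {a : Fin n → K} (ha : a ∈ D)
    (hball : Metric.ball a 1 ⊆ D) :
    ∃ P : FormalMultilinearSeries K (Fin n → K) K, HasFPowerSeriesOnBall F P a 1 := by
  obtain ⟨c, hc⟩ := f.2 ⟨a, ha⟩
  refine Dwork.exists_hasFPowerSeriesOnBall c fun w hw => ?_
  have hmem : a + w ∈ D := hball (by simpa [Metric.mem_ball, dist_eq_norm] using hw)
  have h1 : ‖a + w - a‖ < 1 := by rwa [add_sub_cancel_left]
  refine (hF ⟨a + w, hmem⟩).trans ((hc ⟨a + w, hmem⟩ h1).trans ?_)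
  simp only [add_sub_cancel_left]

theorem exists_evalPt_eq_tsum {π : ℕ → K} (hπ1 : ∀ s, ‖π s‖ ≤ 1) (hπ : Summable fun s => ‖π s‖)
    (f : ℕ → IntegralAnalytic D) :
    ∃ F : IntegralAnalytic D, ∀ a, evalPt a F = ∑' s, π s * evalPt a (f s) :=
  ⟨⟨_, tsum_mem hπ1 hπ fun s => (f s).2⟩, fun _ => rfl⟩

end integralAnalytic

end IntegralAnalytic

/-! ### Completeness of `ℚ_p^{(m)}` and Laurent polynomials as analytic functions -/

section PadicPoints

variable {p : ℕ} [Fact p.Prime] {r n g m : ℕ}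

/-- For `m > 0` only finitely many roots of unity are adjoined, so the extension is finite over
`ℚ_p`. -/
theorem completeSpace_Qpm (hm : 0 < m) : CompleteSpace (Qpm p m) := by
  have hp : p.Prime := Fact.out
  have hpm : p ^ m - 1 ≠ 0 := by
    have := Nat.one_lt_pow hm.ne' hp.one_lt
    omega
  have hfin : Finite {ζ : PadicAlgCl p | ζ ^ (p ^ m - 1) = 1} := by
    refine (Polynomial.nthRootsFinset (p ^ m - 1) (1 : PadicAlgCl p)).finite_toSet.subset ?_
    intro x hx
    rw [Finset.mem_coe, Polynomial.mem_nthRootsFinset (Nat.pos_of_ne_zero hpm)]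
    exact hx
  have : FiniteDimensional ℚ_[p] (Qpm p m) :=
    IntermediateField.finiteDimensional_adjoin fun x _ => Algebra.IsIntegral.isIntegral x
  exact FiniteDimensional.complete ℚ_[p] (Qpm p m)

theorem evalAt_mem_integralAnalytic [CompleteSpace (Qpm p m)] {D : Set (Fin n → Qpm p m)}
    {I : Set (Fin n)} (hD : ∀ a ∈ D, ∀ i, ‖a i‖ ≤ 1) (hDI : ∀ a ∈ D, ∀ i ∈ I, ‖a i‖ = 1)
    {G : LaurentZ p n} (hG : G ∈ supportSubring (negOn I)) :
    (fun a : D => evalAt a.1 G) ∈ integralAnalytic D := by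
  have hsum : (fun a : D => evalAt a.1 G) = ∑ d ∈ G.coeff.support,
      (fun _ : D => algebraMap ℚ_[p] (Qpm p m) (G.coeff d : ℚ_[p])) *
        ∏ i, fun a : D => a.1 i ^ d i := by
    funext a
    simp only [Finset.sum_apply, Pi.mul_apply, Finset.prod_apply]
    rfl
  rw [hsum]
  refine Subring.sum_mem _ fun d hd => Subring.mul_mem _
    (integralAnalytic.const_mem (norm_algebraMap_padicInt_le _)) (Subring.prod_mem _ fun i _ => ?_)
  have hi := integralAnalytic.coord_mem (D := D) i fun a ha => hD a ha i
  rcases Int.eq_nat_or_neg (d i) with ⟨k, hk | hk⟩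
  · simp only [hk, zpow_natCast]
    exact Subring.pow_mem _ hi k
  · by_cases hI : i ∈ I
    · simp only [hk, zpow_neg, zpow_natCast, ← inv_pow]
      exact Subring.pow_mem _ (integralAnalytic.inv_mem hi fun a => hDI a.1 a.2 i hI) k
    · have h0 : d i = 0 := le_antisymm (by omega) (hG d (Finsupp.mem_support_iff.1 hd) i hI)
      simp only [h0, zpow_zero]
      exact Subring.one_mem _

/-- Evaluation on `D` as a ring homomorphism. -/
def evalOn [CompleteSpace (Qpm p m)] {D : Set (Fin n → Qpm p m)}
    {I : Set (Fin n)} (hD : ∀ a ∈ D, ∀ i, ‖a i‖ ≤ 1) (hDI : ∀ a ∈ D, ∀ i ∈ I, ‖a i‖ = 1) :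
    supportSubring (p := p) (negOn I) →+* IntegralAnalytic D where
  toFun G := ⟨_, evalAt_mem_integralAnalytic hD hDI G.2⟩
  map_one' := Subtype.ext (funext fun a => map_one (evalHom (hDI a.1 a.2)))
  map_mul' F G := Subtype.ext (funext fun a => map_mul (evalHom (hDI a.1 a.2)) F G)
  map_zero' := Subtype.ext (funext fun a => map_zero (evalHom (hDI a.1 a.2)))
  map_add' F G := Subtype.ext (funext fun a => map_add (evalHom (hDI a.1 a.2)) F G)

theorem mapMatrix_subtype_injective {A : Type*} [CommRing A] (S : Subring A) :
    Function.Injective (S.subtype.mapMatrix (m := Fin g)) := fun X Y h => by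
  ext1 u v
  exact Subtype.ext (congrFun (congrFun h u) v)

end PadicPoints

/-! ### The domain and the twisted Hasse–Witt system -/

section Domain

variable {p : ℕ} [Fact p.Prime] {r n g m : ℕ}

/-- The variables `z_i` that occur with a negative exponent in some `Λ_l`. -/
def negVars (Λ : ℕ → LaurentTZ p r n) : Set (Fin n) :=
  {i | ∃ l, ∃ k ∈ (Λ l).coeff.support, k.2 i < 0}

theorem mem_supportSubring_negVars (Λ : ℕ → LaurentTZ p r n) (l : ℕ) :
    Λ l ∈ supportSubring
      ((negOn (negVars Λ)).comap (AddMonoidHom.snd (Fin r → ℤ) (Fin n → ℤ))) := by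
  intro k hk i hi
  by_contra h
  exact hi ⟨l, k, Finsupp.mem_support_iff.2 hk, not_le.1 h⟩

theorem ball_subset_domainD [CompleteSpace (Qpm p m)] {e : ℕ → ℕ} {Δ : ℕ → Fin g ↪ (Fin r → ℤ)}
    {Λ : ℕ → LaurentTZ p r n} {a : Fin n → Qpm p m} (ha : a ∈ domainD m e Δ Λ) :
    Metric.ball a 1 ⊆ domainD m e Δ Λ := by
  intro b hb
  rw [Metric.mem_ball, dist_eq_norm] at hb
  have hbi : ∀ i, ‖b i - a i‖ < 1 := fun i => (norm_le_pi_norm (b - a) i).trans_lt hb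
  -- On this larger set, with only the coordinate conditions, each `d_l` is integral analytic; hence
  -- norm `1` at `a` propagates to `b`.
  let D : Set (Fin n → Qpm p m) := {a | (∀ i, ‖a i‖ ≤ 1) ∧ ∀ i ∈ negVars Λ, ‖a i‖ = 1}
  have haD : a ∈ D := ⟨ha.1, ha.2.1⟩
  have hbD : b ∈ D := by
    refine ⟨fun i => ?_, fun i hi => norm_eq_one_of_sub_lt (ha.2.1 i hi) (hbi i)⟩
    have := IsUltrametricDist.norm_add_le_max (b i - a i) (a i)
    rw [sub_add_cancel] at this
    exact this.trans (max_le (hbi i).le (ha.1 i))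
  refine ⟨hbD.1, hbD.2, fun l => ?_⟩
  exact integralAnalytic.norm_eq_one_of_near (D := D) (a := ⟨a, haD⟩) (b := ⟨b, hbD⟩)
    (evalAt_mem_integralAnalytic (I := negVars Λ) (fun a ha => ha.1) (fun a ha => ha.2)
      (det_mem_subring (hasseWitt_mem_supportSubring (mem_supportSubring_negVars Λ l) _ _ _)))
    hb (ha.2.2 l)

theorem det_sigmaMatA (e : ℕ → ℕ) (Δ : ℕ → Fin g ↪ (Fin r → ℤ)) (Λ : ℕ → LaurentTZ p r n)
    (s : ℕ) : (sigmaMatA e Δ Λ s).det = frob (e 1) (matA e Δ Λ 1 s).det := by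
  rw [RingHom.map_det]
  rfl

theorem norm_evalAt_det_sigmaMatA {e : ℕ → ℕ} {Δ : ℕ → Fin g ↪ (Fin r → ℤ)}
    {Λ : ℕ → LaurentTZ p r n} (he : ∀ l, 0 < e (l + 1)) (hadm : Admissible e Δ Λ)
    {a : Fin n → Qpm p m} (ha : a ∈ domainD m e Δ Λ) (s : ℕ) :
    ‖evalAt a (sigmaMatA e Δ Λ s).det‖ = 1 := by
  have hΛ := mem_supportSubring_negVars Λ
  rw [det_sigmaMatA]
  exact norm_evalAt_frob ha.1 ha.2.1 (det_mem_subring (matA_mem_supportSubring e Δ hΛ 1 s))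
    (norm_evalAt_det_matA he hadm hΛ ha.1 ha.2.1 ha.2.2 (by omega)) _

theorem det_map_evalAt {I : Set (Fin n)} {a : Fin n → Qpm p m} (ha : ∀ i ∈ I, ‖a i‖ = 1)
    {X : Matrix (Fin g) (Fin g) (LaurentZ p n)}
    (hX : ∀ u v, X u v ∈ supportSubring (negOn I)) :
    (X.map (evalAt a)).det = evalAt a X.det := by
  let X' : Matrix (Fin g) (Fin g) (supportSubring (p := p) (negOn I)) :=
    Matrix.of fun u v => ⟨X u v, hX u v⟩
  have h1 : X.det = (supportSubring (p := p) (negOn I)).subtype X'.det := by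
    rw [RingHom.map_det]
    rfl
  have h2 := RingHom.map_det (evalHom ha) X'
  rw [evalHom_apply] at h2
  rw [h1]
  exact h2.symm

/-- The Frobenius twists of the Hasse–Witt matrices. -/
def twist (e : ℕ → ℕ) (Δ : ℕ → Fin g ↪ (Fin r → ℤ)) (Λ : ℕ → LaurentTZ p r n) (i s : ℕ) :
    Matrix (Fin g) (Fin g) (supportSubring (p := p) (negOn (negVars Λ))) :=
  Matrix.of fun u v => ⟨frob (esum e 0 i) (matA e Δ Λ i s u v), frob_mem_supportSubring _
    (matA_mem_supportSubring e Δ (mem_supportSubring_negVars Λ) i s u v)⟩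

theorem coe_det_twist (e : ℕ → ℕ) (Δ : ℕ → Fin g ↪ (Fin r → ℤ)) (Λ : ℕ → LaurentTZ p r n)
    (i s : ℕ) :
    ((twist e Δ Λ i s).det : LaurentZ p n) = frob (esum e 0 i) (matA e Δ Λ i s).det := by
  rw [RingHom.map_det]
  exact RingHom.map_det (supportSubring (p := p) (negOn (negVars Λ))).subtype (twist e Δ Λ i s)

/-- The twists form a system as in `prime_pow_dvd_ratio_sub`. -/
theorem exists_twist_expansion {e : ℕ → ℕ} {Δ : ℕ → Fin g ↪ (Fin r → ℤ)}
    {Λ : ℕ → LaurentTZ p r n} (he : ∀ l, 0 < e (l + 1)) (hadm : Admissible e Δ Λ) :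
    ∃ b : ℕ → ℕ → Matrix (Fin g) (Fin g) (supportSubring (p := p) (negOn (negVars Λ))),
      ∀ i s, i ≤ s → twist e Δ Λ i s =
        ∑ j ∈ Finset.Icc i s, (p ^ (j - i) : ℕ) • (b i j * twist e Δ Λ (j + 1) s) := by
  obtain ⟨B, hB, -, hexp⟩ := exists_matA_expansion he hadm (mem_supportSubring_negVars Λ)
  refine ⟨fun i j => Matrix.of fun u v => ⟨_, frob_mem_supportSubring (esum e 0 i) (hB i j u v)⟩,
    fun i s his => mapMatrix_subtype_injective _ ?_⟩
  rw [map_sum]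
  have h := congrArg (frob (esum e 0 i)).mapMatrix (hexp i s his)
  rw [map_sum] at h
  refine Eq.trans h (Finset.sum_congr rfl fun j hj => ?_)
  have hj' := Finset.mem_Icc.1 hj
  rw [map_nsmul, map_nsmul, map_mul, map_mul]
  congr 2
  ext1 u v
  change frob _ (frob _ _) = frob _ _
  -- Twisting row `i` by `e_1+⋯+e_i` absorbs the Frobenius in the expansion, as the exponents add up
  -- to `e_1+⋯+e_{j+1}`.
  rw [frob_frob, esum_add e (Nat.zero_le i) (by omega)]

/-- Once the determinants are units in a target ring, the twisted system yields the ratios `M(0,s)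
M(1,s)⁻¹` together with their congruences. -/
theorem exists_dwork_sequence {e : ℕ → ℕ} {Δ : ℕ → Fin g ↪ (Fin r → ℤ)}
    {Λ : ℕ → LaurentTZ p r n} (he : ∀ l, 0 < e (l + 1)) (hadm : Admissible e Δ Λ)
    {A : Type*} [CommRing A] (ev : supportSubring (p := p) (negOn (negVars Λ)) →+* A)
    (hev : ∀ i s, i ≤ s + 1 → IsUnit (ev (twist e Δ Λ i s).det)) :
    ∃ Q : ℕ → (Matrix (Fin g) (Fin g) A)ˣ,
      (∀ s, ((p ^ (s + 1) : ℕ) : Matrix (Fin g) (Fin g) A) ∣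
        (Q (s + 1) : Matrix (Fin g) (Fin g) A) - Q s) ∧
      ∀ s, (Q s : Matrix (Fin g) (Fin g) A) * ev.mapMatrix (twist e Δ Λ 1 s) =
        ev.mapMatrix (twist e Δ Λ 0 s) := by
  have hunit : ∀ i s, ∃ u : (Matrix (Fin g) (Fin g) A)ˣ,
      i ≤ s + 1 → (u : Matrix (Fin g) (Fin g) A) = ev.mapMatrix (twist e Δ Λ i s) := by
    intro i s
    by_cases his : i ≤ s + 1
    · have hdet : IsUnit (ev.mapMatrix (twist e Δ Λ i s)).det := by
        rw [← RingHom.map_det]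
        exact hev i s his
      exact ⟨((Matrix.isUnit_iff_isUnit_det _).2 hdet).unit, fun _ => rfl⟩
    · exact ⟨1, fun h => absurd h his⟩
  choose M hM using hunit
  obtain ⟨b, hb⟩ := exists_twist_expansion he hadm
  have hrel : ∀ i s, i ≤ s → (M i s : Matrix (Fin g) (Fin g) A) = ∑ j ∈ Finset.Icc i s,
      (p ^ (j - i) : ℕ) • (ev.mapMatrix (b i j) * (M (j + 1) s : Matrix (Fin g) (Fin g) A)) := by
    intro i s his
    rw [hM i s (by omega), hb i s his, map_sum]
    refine Finset.sum_congr rfl fun j hj => ?_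
    rw [map_nsmul, map_mul, hM (j + 1) s (by have := Finset.mem_Icc.1 hj; omega)]
  refine ⟨fun s => M 0 s * (M 1 s)⁻¹,
    fun s => prime_pow_dvd_ratio_sub hrel (Nat.zero_le s), fun s => ?_⟩
  rw [← hM 1 s (by omega), ← hM 0 s (by omega), ← Units.val_mul, inv_mul_cancel_right]

end Domain

/-! ### Uniform limits from Dwork congruences -/

section Limit

variable {K : Type*} [NontriviallyNormedField K] [IsUltrametricDist K] [CompleteSpace K]
  {n g p : ℕ} {D : Set (Fin n → K)}

theorem norm_evalPt_eq_one_of_isUnit {f : IntegralAnalytic D} (hf : IsUnit f) (a : D) :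
    ‖evalPt a f‖ = 1 := by
  obtain ⟨f', hf'⟩ := hf.exists_right_inv
  have h := congrArg (fun f => ‖evalPt a f‖) hf'
  simp only [map_mul, map_one, norm_mul, norm_one] at h
  have h1 := integralAnalytic.norm_evalPt_le f a
  have h2 := integralAnalytic.norm_evalPt_le f' a
  have h3 := norm_nonneg (evalPt a f)
  nlinarith

/-- A sequence of invertible matrices of integral analytic functions that satisfies the Dwork
congruences converges uniformly. -/
theorem exists_limit (hp : ‖(p : K)‖ < 1) {Q : ℕ → (Matrix (Fin g) (Fin g) (IntegralAnalytic D))ˣ}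
    (hQ : ∀ s, ((p ^ (s + 1) : ℕ) : Matrix (Fin g) (Fin g) (IntegralAnalytic D)) ∣
      (Q (s + 1) : Matrix (Fin g) (Fin g) (IntegralAnalytic D)) - Q s) :
    ∃ L : Matrix (Fin g) (Fin g) (IntegralAnalytic D),
      (∀ i j, TendstoUniformly (fun s a => evalPt a ((Q s).val i j)) (fun a => evalPt a (L i j))
        Filter.atTop) ∧
      ∀ a, ‖evalPt a L.det‖ = 1 := by
  choose C hC using hQ
  have hgeom := summable_geometric_of_lt_one (norm_nonneg (p : K)) hp
  choose N hN using fun i j => integralAnalytic.exists_evalPt_eq_tsum (D := D)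
    (π := fun s => (p : K) ^ s)
    (fun s => (norm_pow _ s).trans_le (pow_le_one₀ (norm_nonneg _) hp.le))
    (by simpa only [norm_pow] using hgeom) fun s => C s i j
  -- The telescoping sum `Q_0 + ∑ p^{s+1} C_s`, with one `p` factored out so that `L ≡ Q_0` modulo
  -- `p` is visible.
  let L : Matrix (Fin g) (Fin g) (IntegralAnalytic D) := Matrix.of fun i j =>
    (Q 0).val i j + (p : IntegralAnalytic D) * N i j
  have hL : ∀ i j, L i j = (Q 0).val i j + (p : IntegralAnalytic D) * N i j := fun _ _ => rfl
  refine ⟨L, fun i j => ?_, fun a => ?_⟩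
  · have hstep : ∀ s a, evalPt a ((Q (s + 1)).val i j) =
        evalPt a ((Q s).val i j) + (p : K) ^ (s + 1) * evalPt a (C s i j) := by
      intro s a
      have h := congrFun (congrFun (hC s) i) j
      rw [← nsmul_eq_mul, Matrix.sub_apply, Matrix.smul_apply, nsmul_eq_mul] at h
      have h' := congrArg (evalPt a) h
      rw [map_sub, map_mul, map_natCast, Nat.cast_pow] at h'
      exact sub_eq_iff_eq_add'.1 h'
    have hpart : ∀ s a, evalPt a ((Q s).val i j) = evalPt a ((Q 0).val i j) +
        ∑ k ∈ Finset.range s, (p : K) ^ (k + 1) * evalPt a (C k i j) := by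
      intro s a
      induction s with
      | zero => simp
      | succ s ih => rw [hstep, ih, Finset.sum_range_succ, add_assoc]
    have hlim : ∀ a, evalPt a (L i j) = evalPt a ((Q 0).val i j) +
        ∑' k, (p : K) ^ (k + 1) * evalPt a (C k i j) := by
      intro a
      rw [hL, map_add, map_mul, map_natCast, hN, ← tsum_mul_left]
      simp only [pow_succ', mul_assoc]
    -- The Weierstrass test with the geometric bound `‖p‖^k`, since the values of `C_k` have norm at
    -- most `1`.
    have hu : TendstoUniformly
        (fun s (a : D) => ∑ k ∈ Finset.range s, (p : K) ^ (k + 1) * evalPt a (C k i j))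
        (fun a => ∑' k, (p : K) ^ (k + 1) * evalPt a (C k i j)) Filter.atTop := by
      refine tendstoUniformly_tsum_nat hgeom fun k a => ?_
      rw [norm_mul, norm_pow, pow_succ]
      exact (mul_le_of_le_one_right (by positivity) (integralAnalytic.norm_evalPt_le _ a)).trans
        (mul_le_of_le_one_right (by positivity) hp.le)
    rw [Metric.tendstoUniformly_iff] at hu ⊢
    intro ε hε
    filter_upwards [hu ε hε] with s hs a
    rw [hlim, hpart s a, dist_add_left]
    exact hs a
  · obtain ⟨H, hH⟩ := dvd_det_sub_det (c := (p : IntegralAnalytic D)) (X := L) (Y := (Q 0).val)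
      fun i j => ⟨N i j, by rw [hL, add_sub_cancel_left]⟩
    refine norm_eq_one_of_sub_lt (norm_evalPt_eq_one_of_isUnit
      ((Matrix.isUnit_iff_isUnit_det _).1 (Q 0).isUnit) a) ?_
    rw [← map_sub, hH, map_mul, map_natCast, norm_mul]
    exact (mul_le_of_le_one_right (norm_nonneg _)
      (integralAnalytic.norm_evalPt_le H a)).trans_lt hp

end Limit

end Dwork

end

/-! ### The main theorem -/

theorem mainTheorem6 (p : ℕ) [Fact p.Prime] (hp : p ≠ 2) (m : ℕ) (hm : 0 < m)
    (r n g : ℕ) (hg : 0 < g)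
    (e : ℕ → ℕ) (he : ∀ l, 0 < e (l + 1))
    (Δ : ℕ → Fin g ↪ (Fin r → ℤ)) (Λ : ℕ → Dwork.LaurentTZ p r n)
    (he_fin : (Set.range fun l => e (l + 1)).Finite)
    (hΔ_fin : (Set.range fun l => Set.range (Δ l)).Finite)
    (hΛ_fin : (Set.range Λ).Finite)
    (hadm : Dwork.Admissible e Δ Λ) (hnd : Dwork.Nondegenerate e Δ Λ) :
    -- the entries of the matrices are rational functions regular on the domain
    (∀ s, Dwork.NonzeroModP (Dwork.sigmaMatA e Δ Λ s).det ∧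
      ∀ a ∈ Dwork.domainD m e Δ Λ,
        ‖Dwork.evalAt a (Dwork.sigmaMatA e Δ Λ s).det‖ = 1 ∧
        ((Dwork.sigmaMatA e Δ Λ s).map (Dwork.evalAt a)).det =
          Dwork.evalAt a (Dwork.sigmaMatA e Δ Λ s).det) ∧
    ∃ 𝓐 : (Fin n → Dwork.Qpm p m) → Matrix (Fin g) (Fin g) (Dwork.Qpm p m),
      -- uniform convergence
      (∀ i j, TendstoUniformlyOn (fun s a => Dwork.ratioAt e Δ Λ s a i j) (fun a => 𝓐 a i j)
        Filter.atTop (Dwork.domainD m e Δ Λ)) ∧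
      -- the limit is given by a convergent power series on each unit polydisc of the domain
      (∀ a ∈ Dwork.domainD m e Δ Λ,
        Metric.ball a 1 ⊆ Dwork.domainD m e Δ Λ ∧
        ∀ i j, ∃ P : FormalMultilinearSeries (Dwork.Qpm p m) (Fin n → Dwork.Qpm p m)
            (Dwork.Qpm p m),
          HasFPowerSeriesOnBall (fun z => 𝓐 z i j) P a 1) ∧
      ∀ a ∈ Dwork.domainD m e Δ Λ,
        (∀ i j, ‖𝓐 a i j‖ ≤ 1) ∧ ‖(𝓐 a).det‖ = 1 ∧ IsUnit (𝓐 a) := by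
  classical
  have : CompleteSpace (Dwork.Qpm p m) := Dwork.completeSpace_Qpm hm
  refine ⟨fun s => ⟨?_, fun a ha => ⟨Dwork.norm_evalAt_det_sigmaMatA he hadm ha s, ?_⟩⟩, ?_⟩
  · rw [Dwork.det_sigmaMatA]
    exact (Dwork.nonzeroModP_det_matA he hadm hnd (by omega)).frob _
  · exact Dwork.det_map_evalAt ha.2.1 fun u v => Dwork.frob_mem_supportSubring _
      (Dwork.matA_mem_supportSubring e Δ (Dwork.mem_supportSubring_negVars Λ) 1 s u v)
  let D := Dwork.domainD m e Δ Λ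
  let ev := Dwork.evalOn (D := D) (I := Dwork.negVars Λ) (fun a ha => ha.1) fun a ha => ha.2.1
  have hdet : ∀ i s, i ≤ s + 1 → ∀ a : D,
      ‖Dwork.evalPt a (ev (Dwork.twist e Δ Λ i s).det)‖ = 1 := by
    intro i s his a
    change ‖Dwork.evalAt a.1 ((Dwork.twist e Δ Λ i s).det : Dwork.LaurentZ p n)‖ = 1
    have hΛ := Dwork.mem_supportSubring_negVars Λ
    rw [Dwork.coe_det_twist]
    exact Dwork.norm_evalAt_frob a.2.1 a.2.2.1
      (Dwork.det_mem_subring (Dwork.matA_mem_supportSubring e Δ hΛ i s))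
      (Dwork.norm_evalAt_det_matA he hadm hΛ a.2.1 a.2.2.1 a.2.2.2 his) _
  obtain ⟨Q, hQ, hmul⟩ := Dwork.exists_dwork_sequence he hadm ev fun i s his =>
    Dwork.integralAnalytic.isUnit_of_norm_eq_one _ (hdet i s his)
  have hp1 : ‖(p : Dwork.Qpm p m)‖ < 1 := by
    rw [Dwork.norm_natCast_prime_Qpm]
    exact inv_lt_one_of_one_lt₀ (by exact_mod_cast (Fact.out : p.Prime).one_lt)
  obtain ⟨L, hlim, hdetL⟩ := Dwork.exists_limit hp1 hQ
  -- Twisting by `0` and `e_1` gives the two matrices of the ratio, so `Q_s` evaluated at a point is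
  -- the given matrix of rational functions.
  have hratio : ∀ s (a : D), Dwork.ratioAt e Δ Λ s a.1 =
      (Dwork.evalPt a).mapMatrix (Q s).val := by
    intro s a
    have h := congrArg (Dwork.evalPt a).mapMatrix (hmul s)
    have h0 : (Dwork.evalPt a).mapMatrix (ev.mapMatrix (Dwork.twist e Δ Λ 0 s)) =
        (Dwork.matA e Δ Λ 0 s).map (Dwork.evalAt a.1) := by
      ext1 u v
      change Dwork.evalAt a.1 (Dwork.frob _ _) = _
      rw [Dwork.esum_self, Dwork.frob_zero, Matrix.map_apply]
    have h1 : (Dwork.evalPt a).mapMatrix (ev.mapMatrix (Dwork.twist e Δ Λ 1 s)) =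
        (Dwork.sigmaMatA e Δ Λ s).map (Dwork.evalAt a.1) := by
      ext1 u v
      change Dwork.evalAt a.1 (Dwork.frob _ _) = _
      rw [Dwork.esum_succ_self]
      rfl
    have hu : IsUnit ((Dwork.sigmaMatA e Δ Λ s).map (Dwork.evalAt a.1)).det := by
      rw [← h1, ← RingHom.map_det, ← RingHom.map_det, isUnit_iff_ne_zero, ← norm_ne_zero_iff,
        hdet 1 s (by omega)]
      exact one_ne_zero
    rw [map_mul, h0, h1] at h
    rw [Dwork.ratioAt, ← h, Matrix.mul_nonsing_inv_cancel_right _ _ hu]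
  let 𝓐 : (Fin n → Dwork.Qpm p m) → Matrix (Fin g) (Fin g) (Dwork.Qpm p m) := fun z =>
    -- The value `0` off the domain is immaterial: convergence is asserted on the domain, and the
    -- polydiscs lie inside it.
    if h : z ∈ D then (Dwork.evalPt (⟨z, h⟩ : D)).mapMatrix L else 0
  have hA : ∀ a : D, 𝓐 a.1 = (Dwork.evalPt a).mapMatrix L := fun a => dif_pos a.2
  refine ⟨𝓐, fun i j => ?_, fun a ha => ⟨Dwork.ball_subset_domainD ha, fun i j => ?_⟩,
    fun a ha => ?_⟩
  · have h := hlim i j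
    rw [Metric.tendstoUniformly_iff] at h
    rw [Metric.tendstoUniformlyOn_iff]
    intro ε hε
    filter_upwards [h ε hε] with s hs a ha
    rw [hA ⟨a, ha⟩, hratio s ⟨a, ha⟩]
    exact hs ⟨a, ha⟩
  · refine Dwork.integralAnalytic.exists_hasFPowerSeriesOnBall (L i j) (fun b => ?_) ha
      (Dwork.ball_subset_domainD ha)
    rw [hA b]
    rfl
  · have hn : ‖(𝓐 a).det‖ = 1 := by
      rw [hA ⟨a, ha⟩, ← RingHom.map_det]
      exact hdetL ⟨a, ha⟩
    refine ⟨fun i j => ?_, hn, ?_⟩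
    · rw [hA ⟨a, ha⟩]
      exact Dwork.integralAnalytic.norm_evalPt_le (L i j) ⟨a, ha⟩
    · rw [Matrix.isUnit_iff_isUnit_det, isUnit_iff_ne_zero, ← norm_ne_zero_iff, hn]
      exact one_ne_zero
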